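/- Let $M$ be an $n$-dimensional semisimple Frobenius manifold with flat coordinates $v^1,\dots,v^n$, potential $F(v)$, flat metric $\eta_{\alpha\beta}=\partial_1\partial_\alpha\partial_\beta F$ and unit $e=\partial/\partial v^1$, and let $\theta_{\alpha,p}(v)$ be a calibration: $\theta_\alpha(v;z)=\sum_{p\ge0}\theta_{\alpha,p}(v)z^p$ with $\theta_\alpha(v;0)=\eta_{\alpha\gamma}v^\gamma$, $\partial_\alpha\partial_\beta\theta_\gamma(v;z)=z\,c^\xi_{\alpha\beta}\partial_\xi\theta_\gamma(v;z)$, $\langle\nabla\theta_\alpha(v;-z),\nabla\theta_\beta(v;z)\rangle=\eta_{\alpha\beta}$. Let $v(\mathbf t)$ be the topological solution of the principal hierarchy, i.e. a holomorphic solution of $\sum\tilde t^{\alpha,p}\nabla\theta_{\alpha,p}(v)=0$, $\tilde t^{\alpha,p}=t^{\alpha,p}-\delta^\alpha_1\delta^p_1$, where only finitely many times $t^{\alpha,p}$ are nonzero, and let $$\mathcal F_0=\tfrac12\sum\tilde t^{\alpha,p}\tilde t^{\beta,q}\,\Omega_{\alpha,p;\beta,q}(v(\mathbf t)),\qquad \sum_{p,q\ge0}\Omega_{\alpha,p;\beta,q}(v)z^pw^q=\frac{\langle\nabla\theta_\alpha(v;z),\nabla\theta_\beta(v;w)\rangle-\eta_{\alpha\beta}}{z+w}$$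 be the genus zero free energy. Put $x=t^{1,0}$ and $M_{\alpha\beta}=\partial^3\mathcal F_0/\partial t^{1,0}\partial t^{\alpha,0}\partial t^{\beta,0}$. To a graph all of whose vertices have genus zero one associates a function of $\mathbf t$: each vertex stands for $\mathcal F_0$, each leg for $\partial/\partial t^{1,0}$ acting on its vertex, and each edge for $(M^{-1})^{\alpha\alpha'}\,\partial_{t^{\alpha,0}}\otimes\partial_{t^{\alpha',0}}$ acting on its two end vertices (contractions are performed at the end). Write $A^k$ for a vertex $A$ with $k$ legs, $AB$ for an edge, $AA$ for a loop, and exponents for multiplicities of edges. Consider - $O_1$: $A^0$; $AA,AA$. $\quad O_2$: $A^1,B^0$; $(AB)^3$. - $P_1$: $A^1$; $AA,AA$. $\quad P_2$: $A^0,B^2$; $AA,(AB)^2$. $\quad P_3$: $A^1,B^0,C^2$; $(AB)^2,AC,BC$. $\quad P_4$: $A^2,B^0$; $(AB)^3$. $\quad P_5$: $A^1,B^1$; $(AB)^3$. - $Q_1$: $A^2$; $AA,AA$. $\quad Q_2$: $A^1,B^2$; $(AB)^3$. $\quad Q_3$: $A^1,B^2$; $AA,(AB)^2$. $\quad Q_4$: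 $A^1,B^1,C^2$; $(AB)^2,AC,BC$. $\quad Q_5$: $A^0,B^3$; $AA,(AB)^2$. $\quad Q_6$: $A^3,B^0$; $(AB)^3$. - $Q_7$: $A^0,B^2,C^2$; $(AB)^2,(AC)^2$. $\quad Q_8$: $A^1,B^0,C^3$; $(AB)^2,AC,BC$. $\quad Q_9$: $A^0,B^2,C^2$; $AA,AB,AC,BC$. $\quad Q_{10}$: $A^2,B^0,C^2$; $(AB)^2,AC,BC$. - $Q_{11}$: $A^1,B^0,C^2,D^2$; $AB,AC,BC,AD,BD$. $\quad Q_{12}$: $A^1,B^0,C^2,D^2$; $(AB)^2,AC,CD,BD$. Then the matrix $M$ is invertible, so these functions are defined, and the following hold. (1) In any local canonical coordinates $u_1,\dots,u_n$ (i.e. $\partial_{u_i}\cdot\partial_{u_j}=\delta_{ij}\partial_{u_i}$), with Lamé coefficients $h_i=\sqrt{\langle\partial_{u_i},\partial_{u_i}\rangle}$ (any holomorphic choice of signs) and rotation coefficients $\gamma_{ij}=h_i^{-1}\,\partial h_j/\partial u_i$ ($i\ne j$), the $h_i$ do not vanish and $$O_1-O_2=\sum_{1\le i<j\le n}\gamma_{ij}\,\frac{(h_i^2+h_j^2)^2}{h_i^3h_j^3},$$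 where the right-hand side is evaluated at $v(\mathbf t)$. (2) One has $$\begin{aligned} \partial_xP_1&=Q_1-2Q_3, & \partial_xP_2&=Q_3+Q_5-Q_7-2Q_9,\\ \partial_xP_3&=Q_4+Q_8+Q_{10}-2Q_{11}-2Q_{12}, & \partial_xP_4&=Q_6+Q_2-3Q_{10},\\ \partial_xP_5&=2Q_2-3Q_4, & \partial_xO_1&=P_1-2P_2,\\ \partial_xO_2&=P_4+P_5-3P_3, \end{aligned}$$ and $$(Q_1-Q_6)+2(Q_7-Q_5)+3(Q_8-Q_2)+4(Q_9-Q_3)+6(Q_4+Q_{10}-Q_{11}-Q_{12})=\partial_x^2(O_1-O_2).$$ -/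

import Mathlib

/-- The partial derivative `∂f/∂x_i` of a function of `n` complex variables. -/
noncomputable def pd {n : ℕ} (i : Fin n) (f : (Fin n → ℂ) → ℂ) : (Fin n → ℂ) → ℂ :=
  fun x => fderiv ℂ f x (Pi.single i 1)

/-- Third derivatives `c_{αβγ} = ∂³F/∂v^α∂v^β∂v^γ` of a potential. -/
noncomputable def thirdDeriv {n : ℕ} (F : (Fin n → ℂ) → ℂ) (α β γ : Fin n) :
    (Fin n → ℂ) → ℂ :=
  pd α (pd β (pd γ F))

/-- Structure constants `c^γ_{αβ} = η^{γδ} c_{αβδ}`, so that `∂_α · ∂_β = c^γ_{αβ} ∂_γ`. -/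
noncomputable def structConst {n : ℕ} (F : (Fin n → ℂ) → ℂ) (η : Matrix (Fin n) (Fin n) ℂ)
    (γ α β : Fin n) : (Fin n → ℂ) → ℂ :=
  fun v => ∑ δ, η⁻¹ γ δ * thirdDeriv F α β δ v

/-- An `n`-dimensional (complex analytic) Frobenius manifold in a chart of flat coordinates
`v = (v^1, …, v^n)`. The flat coordinates are numbered from `0`: the coordinate `v^1` with
`e = ∂/∂v^1` is `v 0`. Every Frobenius manifold is covered by such charts. -/
structure FrobeniusManifold (n : ℕ) [NeZero n] where
  /-- the range of the flat coordinates -/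
  domain : Set (Fin n → ℂ)
  isOpen_domain : IsOpen domain
  /-- the potential `F(v)` -/
  potential : (Fin n → ℂ) → ℂ
  analytic_potential : AnalyticOnNhd ℂ potential domain
  /-- the Gram matrix `η_{αβ} = ⟨∂_α, ∂_β⟩` of the flat metric -/
  eta : Matrix (Fin n) (Fin n) ℂ
  eta_symm : eta.IsSymm
  eta_nondeg : IsUnit eta.det
  /-- `∂_1 ∂_α ∂_β F = η_{αβ}`; equivalently, `e = ∂/∂v^1` is the unit of the product -/
  eta_eq : ∀ v ∈ domain, ∀ α β, thirdDeriv potential 0 α β v = eta α β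
  /-- associativity of the product -/
  assoc : ∀ v ∈ domain, ∀ α β γ δ,
    ∑ μ, structConst potential eta μ α β v * structConst potential eta δ μ γ v =
      ∑ μ, structConst potential eta μ β γ v * structConst potential eta δ α μ v
  /-- the charge `d` -/
  charge : ℂ
  /-- the components `E^α(v)` of the Euler vector field -/
  euler : Fin n → (Fin n → ℂ) → ℂ
  analytic_euler : ∀ α, AnalyticOnNhd ℂ (euler α) domain
  /-- `∇∇E = 0` -/
  euler_affine : ∀ v ∈ domain, ∀ α β γ, pd α (pd β (euler γ)) v = 0
  /-- `L_E ⟨ , ⟩ = (2 - d) ⟨ , ⟩` -/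
  euler_metric : ∀ v ∈ domain, ∀ α β,
    ∑ γ, (pd α (euler γ) v * eta γ β + pd β (euler γ) v * eta α γ) = (2 - charge) * eta α β
  /-- `L_E (·) = (·)` -/
  euler_product : ∀ v ∈ domain, ∀ α β γ,
    ∑ ξ, (euler ξ v * pd ξ (structConst potential eta γ α β) v
        + pd α (euler ξ) v * structConst potential eta γ ξ β v
        + pd β (euler ξ) v * structConst potential eta γ α ξ v
        - pd ξ (euler γ) v * structConst potential eta ξ α β v)
      = structConst potential eta γ α β v

namespace FrobeniusManifold

variable {n : ℕ} [NeZero n]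

/-- The pairing `⟨∇f, ∇g⟩ = η^{μν} ∂_μ f ∂_ν g` of two gradients. -/
noncomputable def gradPair (X : FrobeniusManifold n) (f g : (Fin n → ℂ) → ℂ) (v : Fin n → ℂ) :
    ℂ :=
  ∑ μ, ∑ ν, X.eta⁻¹ μ ν * pd μ f v * pd ν g v

/-- A calibration: functions `θ_{α,p}(v)`, `p ≥ 0`, with generating series
`θ_α(v; z) = ∑_p θ_{α,p}(v) z^p`, such that `θ_α(v; 0) = η_{αγ} v^γ`,
`∂_α ∂_β θ_γ(v; z) = z c^ξ_{αβ} ∂_ξ θ_γ(v; z)` and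
`⟨∇θ_α(v; -z), ∇θ_β(v; z)⟩ = η_{αβ}`.
The homogeneity of `θ` with respect to the Euler field is not required. -/
structure Calibration (X : FrobeniusManifold n) where
  /-- the functions `θ_{α,p}` -/
  theta : Fin n → ℕ → (Fin n → ℂ) → ℂ
  analytic_theta : ∀ α p, AnalyticOnNhd ℂ (theta α p) X.domain
  theta_zero : ∀ v ∈ X.domain, ∀ α, theta α 0 v = ∑ γ, X.eta α γ * v γ
  theta_succ : ∀ v ∈ X.domain, ∀ α β γ p,
    pd α (pd β (theta γ (p + 1))) v =
      ∑ ξ, structConst X.potential X.eta ξ α β v * pd ξ (theta γ p) v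
  theta_orth : ∀ v ∈ X.domain, ∀ α β p,
    ∑ m ∈ Finset.range (p + 1), (-1) ^ m * X.gradPair (theta α m) (theta β (p - m)) v =
      if p = 0 then X.eta α β else 0

/-- The genus zero two-point functions `Ω_{α,p;β,q}(v)`, the coefficients of
`∑_{p,q} Ω_{α,p;β,q} z^p w^q = (⟨∇θ_α(v; z), ∇θ_β(v; w)⟩ - η_{αβ}) / (z + w)`. -/
noncomputable def Calibration.twoPoint {X : FrobeniusManifold n} (Θ : X.Calibration)
    (α : Fin n) (p : ℕ) (β : Fin n) (q : ℕ) (v : Fin n → ℂ) : ℂ :=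
  ∑ m ∈ Finset.range (q + 1),
    (-1) ^ m * X.gradPair (Θ.theta α (p + m + 1)) (Θ.theta β (q - m)) v

/-- The shifted times `t^{α,p} - δ^α_1 δ^p_1` on the large phase space. The primary times
`t^{α,0}` are `t α`, the descendant times `t^{α,p}`, `p ≥ 1`, are `s p α` (`s 0` is not used). -/
noncomputable def shiftedTime (s : ℕ → Fin n → ℂ) (t : Fin n → ℂ) (p : ℕ) (α : Fin n) : ℂ :=
  (if p = 0 then t α else s p α) - (if p = 1 ∧ α = 0 then 1 else 0)

/-- `v(t)` solves the Euler-Lagrange equation `∑ (t^{α,p} - δ^α_1 δ^p_1) ∇θ_{α,p}(v) = 0`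
which determines the topological solution of the principal hierarchy.
The times `t^{α,p}` with `p > N` vanish, the remaining descendant times `s` are fixed
parameters, and `v` is a holomorphic function of the primary times `t^{α,0}` in the open
set `U`. -/
structure IsTopologicalSolution (X : FrobeniusManifold n) (Θ : X.Calibration)
    (N : ℕ) (s : ℕ → Fin n → ℂ) (U : Set (Fin n → ℂ)) (v : (Fin n → ℂ) → (Fin n → ℂ)) :
    Prop where
  isOpen : IsOpen U
  analytic : AnalyticOnNhd ℂ v U
  mapsTo : Set.MapsTo v U X.domain
  eulerLagrange : ∀ t ∈ U, ∀ β,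
    ∑ p ∈ Finset.range (N + 1), ∑ α, shiftedTime s t p α * pd β (Θ.theta α p) (v t) = 0

/-- The genus zero free energy
`𝓕₀ = 1/2 ∑ (t^{α,p} - δ^α_1 δ^p_1) (t^{β,q} - δ^β_1 δ^q_1) Ω_{α,p;β,q}(v(t))`,
as a function of the primary times; the times `t^{α,p}` with `p > N` vanish. -/
noncomputable def Calibration.freeEnergy {X : FrobeniusManifold n} (Θ : X.Calibration)
    (N : ℕ) (s : ℕ → Fin n → ℂ) (v : (Fin n → ℂ) → (Fin n → ℂ)) (t : Fin n → ℂ) : ℂ :=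
  1 / 2 * ∑ p ∈ Finset.range (N + 1), ∑ q ∈ Finset.range (N + 1), ∑ α, ∑ β,
    shiftedTime s t p α * shiftedTime s t q β * Θ.twoPoint α p β q (v t)

/-- Canonical coordinates `u = (u_1, …, u_n)` on an open part of the Frobenius manifold: local
coordinates with `∂/∂u_i · ∂/∂u_j = δ_{ij} ∂/∂u_i`. They exist in a neighbourhood of `v` if
and only if the product on the tangent space at `v` is semisimple. -/
structure CanonicalCoordinates (X : FrobeniusManifold n) where
  /-- the change of coordinates `v ↦ u(v)`, with inverse `u ↦ v(u)` -/
  chart : OpenPartialHomeomorph (Fin n → ℂ) (Fin n → ℂ)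
  source_subset : chart.source ⊆ X.domain
  analytic : AnalyticOnNhd ℂ chart chart.source
  analytic_symm : AnalyticOnNhd ℂ chart.symm chart.target
  mul_frame : ∀ u ∈ chart.target, ∀ i j γ,
    ∑ α, ∑ β, structConst X.potential X.eta γ α β (chart.symm u) *
        pd i (fun w => chart.symm w α) u * pd j (fun w => chart.symm w β) u =
      if i = j then pd i (fun w => chart.symm w γ) u else 0

namespace CanonicalCoordinates

/-- The diagonal coefficients `η_{ii}(u) = ⟨∂/∂u_i, ∂/∂u_i⟩` of the metric. -/
noncomputable def metricCoeff {X : FrobeniusManifold n} (K : X.CanonicalCoordinates)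
    (i : Fin n) (u : Fin n → ℂ) : ℂ :=
  ∑ α, ∑ β, X.eta α β *
    pd i (fun w => K.chart.symm w α) u * pd i (fun w => K.chart.symm w β) u

/-- `h_1, …, h_n` are the Lamé coefficients `h_i(u) = √η_{ii}(u)` for some holomorphic choice of
the signs of the square roots. -/
structure IsLame {X : FrobeniusManifold n} (K : X.CanonicalCoordinates)
    (h : Fin n → (Fin n → ℂ) → ℂ) : Prop where
  analytic : ∀ i, AnalyticOnNhd ℂ (h i) K.chart.target
  sq_eq : ∀ i, ∀ u ∈ K.chart.target, h i u ^ 2 = K.metricCoeff i u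

end CanonicalCoordinates

end FrobeniusManifold

/-- The rotation coefficients `γ_{ij} = h_i⁻¹ ∂h_j/∂u_i` for `i ≠ j`, and `γ_{ii} = 0`. -/
noncomputable def rotationCoeff {n : ℕ} (h : Fin n → (Fin n → ℂ) → ℂ) (i j : Fin n)
    (u : Fin n → ℂ) : ℂ :=
  if i = j then 0 else pd i (h j) u / h i u

/-- The correlation function `∂^m 𝓕₀ / ∂t^{α_1,0} ⋯ ∂t^{α_m,0}` for a list `α_1, …, α_m`. -/
noncomputable def corr {n : ℕ} (F₀ : (Fin n → ℂ) → ℂ) : List (Fin n) → (Fin n → ℂ) → ℂ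
  | [] => F₀
  | α :: l => pd α (corr F₀ l)

/-- The matrix `M_{αβ} = ∂³𝓕₀ / ∂t^{1,0} ∂t^{α,0} ∂t^{β,0}`. -/
noncomputable def corrMatrix {n : ℕ} [NeZero n] (F₀ : (Fin n → ℂ) → ℂ) (t : Fin n → ℂ) :
    Matrix (Fin n) (Fin n) ℂ :=
  Matrix.of fun α β => corr F₀ [0, α, β] t

/-- A dual graph all of whose vertices have genus zero (bullets): `numVertices` vertices, each
with a number of legs, and `numEdges` edges, each given by its two end points (a loop has two
equal end points; multiple edges are allowed). -/
structure DualGraph where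
  numVertices : ℕ
  numEdges : ℕ
  ends : Fin numEdges → Fin numVertices × Fin numVertices
  legs : Fin numVertices → ℕ

/-- The function of the primary times associated to a dual graph. The two half-edges of each
edge `e` carry indices `a e` and `b e`. A vertex contributes the derivative of `𝓕₀` along
`∂/∂t^{1,0}` for each of its legs and along `∂/∂t^{α,0}` for each of its half-edges with index
`α`; the edge `e` contributes `(M⁻¹)^{a e, b e}`; one sums over all indices. -/
noncomputable def DualGraph.value {n : ℕ} [NeZero n] (Γ : DualGraph) (F₀ : (Fin n → ℂ) → ℂ)
    (t : Fin n → ℂ) : ℂ :=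
  ∑ a : Fin Γ.numEdges → Fin n, ∑ b : Fin Γ.numEdges → Fin n,
    (∏ e, (corrMatrix F₀ t)⁻¹ (a e) (b e)) *
      ∏ w, corr F₀ (List.replicate (Γ.legs w) 0 ++
        (List.finRange Γ.numEdges).flatMap fun e =>
          (if (Γ.ends e).1 = w then [a e] else []) ++
          (if (Γ.ends e).2 = w then [b e] else [])) t

/-- one vertex with two loops -/
def graphO1 : DualGraph := ⟨1, 2, ![(0, 0), (0, 0)], ![0]⟩
/-- two vertices joined by three edges; one leg -/
def graphO2 : DualGraph := ⟨2, 3, ![(0, 1), (0, 1), (0, 1)], ![1, 0]⟩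

def graphP1 : DualGraph := ⟨1, 2, ![(0, 0), (0, 0)], ![1]⟩
def graphP2 : DualGraph := ⟨2, 3, ![(0, 0), (0, 1), (0, 1)], ![0, 2]⟩
def graphP3 : DualGraph := ⟨3, 4, ![(0, 1), (0, 1), (0, 2), (1, 2)], ![1, 0, 2]⟩
def graphP4 : DualGraph := ⟨2, 3, ![(0, 1), (0, 1), (0, 1)], ![2, 0]⟩
def graphP5 : DualGraph := ⟨2, 3, ![(0, 1), (0, 1), (0, 1)], ![1, 1]⟩

def graphQ1 : DualGraph := ⟨1, 2, ![(0, 0), (0, 0)], ![2]⟩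
def graphQ2 : DualGraph := ⟨2, 3, ![(0, 1), (0, 1), (0, 1)], ![1, 2]⟩
def graphQ3 : DualGraph := ⟨2, 3, ![(0, 0), (0, 1), (0, 1)], ![1, 2]⟩
def graphQ4 : DualGraph := ⟨3, 4, ![(0, 1), (0, 1), (0, 2), (1, 2)], ![1, 1, 2]⟩
def graphQ5 : DualGraph := ⟨2, 3, ![(0, 0), (0, 1), (0, 1)], ![0, 3]⟩
def graphQ6 : DualGraph := ⟨2, 3, ![(0, 1), (0, 1), (0, 1)], ![3, 0]⟩
def graphQ7 : DualGraph := ⟨3, 4, ![(0, 1), (0, 1), (0, 2), (0, 2)], ![0, 2, 2]⟩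
def graphQ8 : DualGraph := ⟨3, 4, ![(0, 1), (0, 1), (0, 2), (1, 2)], ![1, 0, 3]⟩
def graphQ9 : DualGraph := ⟨3, 4, ![(0, 0), (0, 1), (0, 2), (1, 2)], ![0, 2, 2]⟩
def graphQ10 : DualGraph := ⟨3, 4, ![(0, 1), (0, 1), (0, 2), (1, 2)], ![2, 0, 2]⟩
def graphQ11 : DualGraph := ⟨4, 5, ![(0, 1), (0, 2), (1, 2), (0, 3), (1, 3)], ![1, 0, 2, 2]⟩
def graphQ12 : DualGraph := ⟨4, 5, ![(0, 1), (0, 1), (0, 2), (2, 3), (1, 3)], ![1, 0, 2, 2]⟩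

/-- `(Q₁-Q₆) + 2(Q₇-Q₅) + 3(Q₈-Q₂) + 4(Q₉-Q₃) + 6(Q₄+Q₁₀-Q₁₁-Q₁₂)` -/
noncomputable def graphRelation {n : ℕ} [NeZero n] (F₀ : (Fin n → ℂ) → ℂ) (t : Fin n → ℂ) : ℂ :=
  (graphQ1.value F₀ t - graphQ6.value F₀ t)
    + 2 * (graphQ7.value F₀ t - graphQ5.value F₀ t)
    + 3 * (graphQ8.value F₀ t - graphQ2.value F₀ t)
    + 4 * (graphQ9.value F₀ t - graphQ3.value F₀ t)
    + 6 * (graphQ4.value F₀ t + graphQ10.value F₀ t - graphQ11.value F₀ t - graphQ12.value F₀ t)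

/-! Everything rests on the third derivatives of the free energy. The calibration equations give
`∂_ξ Ω = c_ξ(∇θ, ∇θ)` (`pd_twoPoint`), so by the Euler-Lagrange equation the terms in which `Ω`
itself is differentiated drop out of the first two derivatives of `𝓕₀`. Thus `∂_γ ∂_α 𝓕₀ =
Ω_{α,0;γ,0}(v)`, and one more derivative gives `c_{ξγα}(v) ∂_δ v^ξ` (`corr_three`). In particular `M
= J η` with `J` the Jacobian of `v`; differentiating the Euler-Lagrange equation shows that `J`
times a matrix is `-η`, hence `M` is invertible.

The derivatives of graphs are the Leibniz rule: `∂_x` adds a leg to a vertex, and `∂_x M⁻¹ = -M⁻¹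
(∂_x M) M⁻¹` inserts a vertex with two legs into an edge, with a minus sign (`pd_contract`).
Identifying the resulting graphs is a finite check of isomorphisms, and the last relation is linear
algebra with the resulting formulas.

For `O₁ - O₂` all tensors are expanded in the frame `f_i = ∂/∂u_i`. It diagonalises `η` (entries
`η_ii`), `M` (entries `m_i`) and the three-point tensor. Since the three-point tensor vanishes on
`(·, f_i, f_j)` for `i ≠ j`, differentiating this zero along `f_l` yields the four-point tensor on
such arguments in terms of `∂_i η_jj` (`corrForm₄_frame`). Writing the leg of `O₂` as `e = ∑ f_j`,
both graphs become double sums over `i, j`. The diagonal terms, which involve the uncomputed value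
on `(f_i, f_i, f_i, f_i)`, cancel; off the diagonal every `m_i` cancels, leaving `(∂_i η_jj /
2)(1/(η_ii η_jj) + 1/η_ii²)`. Adding the terms `(i, j)` and `(j, i)` by the Egorov symmetry `∂_i
η_jj = ∂_j η_ii = 2 h_i h_j γ_ij` produces the perfect square `(h_i² + h_j²)²`. -/

/-! ### Calculus of partial derivatives of analytic functions. -/

section PartialDerivatives

variable {n : ℕ} {i j : Fin n} {f g : (Fin n → ℂ) → ℂ} {x : Fin n → ℂ}

theorem pd_congr_of_eventuallyEq (h : f =ᶠ[nhds x] g) : pd i f x = pd i g x := by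
  simp only [pd, h.fderiv_eq]

theorem pd_congr_of_eqOn {U : Set (Fin n → ℂ)} (hU : IsOpen U) (h : Set.EqOn f g U)
    (hx : x ∈ U) : pd i f x = pd i g x :=
  pd_congr_of_eventuallyEq (Filter.eventuallyEq_of_mem (hU.mem_nhds hx) h)

theorem AnalyticAt.pd (hf : AnalyticAt ℂ f x) (i : Fin n) : AnalyticAt ℂ (pd i f) x := by
  have h := ((ContinuousLinearMap.apply ℂ ℂ (Pi.single i (1 : ℂ) : Fin n → ℂ)).analyticAt
    (fderiv ℂ f x)).comp hf.fderiv
  exact h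

theorem AnalyticOnNhd.pd {U : Set (Fin n → ℂ)} (hf : AnalyticOnNhd ℂ f U) (i : Fin n) :
    AnalyticOnNhd ℂ (pd i f) U := fun x hx => (hf x hx).pd i

theorem pd_const (c : ℂ) : pd i (fun _ => c) x = 0 := by simp [pd]

theorem pd_coord (j : Fin n) : pd i (fun y => y j) x = if i = j then 1 else 0 := by
  have : HasFDerivAt (fun y : Fin n → ℂ => y j)
      (ContinuousLinearMap.proj (R := ℂ) (φ := fun _ : Fin n => ℂ) j) x :=
    (ContinuousLinearMap.proj (R := ℂ) (φ := fun _ : Fin n => ℂ) j).hasFDerivAt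
  rw [_root_.pd, this.fderiv]
  simp [Pi.single_apply, eq_comm]

theorem pd_add (hf : AnalyticAt ℂ f x) (hg : AnalyticAt ℂ g x) :
    pd i (fun y => f y + g y) x = pd i f x + pd i g x := by
  simp only [pd]
  rw [fderiv_fun_add hf.differentiableAt hg.differentiableAt]; rfl

theorem pd_sub (hf : AnalyticAt ℂ f x) (hg : AnalyticAt ℂ g x) :
    pd i (fun y => f y - g y) x = pd i f x - pd i g x := by
  simp only [pd]
  rw [fderiv_fun_sub hf.differentiableAt hg.differentiableAt]; rfl

theorem pd_mul (hf : AnalyticAt ℂ f x) (hg : AnalyticAt ℂ g x) :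
    pd i (fun y => f y * g y) x = pd i f x * g x + f x * pd i g x := by
  simp only [pd]
  rw [fderiv_fun_mul hf.differentiableAt hg.differentiableAt]
  simp [mul_comm, add_comm]

theorem pd_const_mul (c : ℂ) (hf : AnalyticAt ℂ f x) :
    pd i (fun y => c * f y) x = c * pd i f x := by
  rw [pd_mul analyticAt_const hf, pd_const]; ring

theorem pd_sum {ι : Type*} (s : Finset ι) {F : ι → (Fin n → ℂ) → ℂ}
    (hF : ∀ k ∈ s, AnalyticAt ℂ (F k) x) :
    pd i (fun y => ∑ k ∈ s, F k y) x = ∑ k ∈ s, pd i (F k) x := by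
  simp only [pd]
  rw [fderiv_fun_sum fun k hk => (hF k hk).differentiableAt]
  simp

theorem pd_prod {ι : Type*} [DecidableEq ι] (s : Finset ι) {F : ι → (Fin n → ℂ) → ℂ}
    (hF : ∀ k ∈ s, AnalyticAt ℂ (F k) x) :
    pd i (fun y => ∏ k ∈ s, F k y) x = ∑ k ∈ s, (∏ l ∈ s.erase k, F l x) * pd i (F k) x := by
  simp only [pd]
  erw [fderiv_finsetProd fun k hk => (hF k hk).differentiableAt]
  simp

/-- The derivative along a vector is the combination of the partial derivatives. -/
theorem fderiv_apply_eq_sum_pd (f : (Fin n → ℂ) → ℂ) (x y : Fin n → ℂ) :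
    fderiv ℂ f x y = ∑ k, y k * pd k f x := by
  have hy : y = ∑ k, y k • (Pi.single k 1 : Fin n → ℂ) := by
    ext j
    simp [Finset.sum_apply, Pi.single_apply]
  conv_lhs => rw [hy]
  simp [pd, map_sum]

theorem pd_comp {w : (Fin n → ℂ) → (Fin n → ℂ)} (hf : AnalyticAt ℂ f (w x))
    (hw : AnalyticAt ℂ w x) :
    pd i (fun y => f (w y)) x = ∑ k, pd k f (w x) * pd i (fun y => w y k) x := by
  have h := hf.differentiableAt.hasFDerivAt.comp x hw.differentiableAt.hasFDerivAt
  have hk : ∀ k, HasFDerivAt (fun y => w y k)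
      ((ContinuousLinearMap.proj (R := ℂ) (φ := fun _ : Fin n => ℂ) k).comp (fderiv ℂ w x)) x :=
    fun k => hasFDerivAt_pi'.1 hw.differentiableAt.hasFDerivAt k
  have hk' : ∀ k, pd i (fun y => w y k) x = fderiv ℂ w x (Pi.single i 1) k := fun k => by
    rw [pd, (hk k).fderiv]; rfl
  rw [pd]
  erw [h.fderiv]
  rw [ContinuousLinearMap.comp_apply, fderiv_apply_eq_sum_pd]
  exact Finset.sum_congr rfl fun k _ => by rw [hk', mul_comm]

theorem pd_comm (hf : AnalyticAt ℂ f x) : pd i (pd j f) x = pd j (pd i f) x := by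
  have hs : IsSymmSndFDerivAt ℂ f x := hf.contDiffAt.isSymmSndFDerivAt_of_omega
  have key : ∀ a b : Fin n, pd a (pd b f) x
      = fderiv ℂ (fderiv ℂ f) x (Pi.single a 1) (Pi.single b 1) := fun a b => by
    have h := hf.fderiv.differentiableAt.hasFDerivAt.clm_apply
      (hasFDerivAt_const (Pi.single b (1 : ℂ)) x)
    rw [pd]
    erw [h.fderiv]
    simp
  rw [key, key]
  exact hs _ _

theorem AnalyticAt.coord {w : (Fin n → ℂ) → (Fin n → ℂ)} (hw : AnalyticAt ℂ w x) (k : Fin n) :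
    AnalyticAt ℂ (fun y => w y k) x :=
  ((ContinuousLinearMap.proj (R := ℂ) (φ := fun _ : Fin n => ℂ) k).analyticAt _).comp hw

end PartialDerivatives

/-! ### Symmetry of the correlators. -/

section Correlators

variable {n : ℕ} {F₀ : (Fin n → ℂ) → ℂ} {U : Set (Fin n → ℂ)}

theorem analyticOnNhd_corr (hF : AnalyticOnNhd ℂ F₀ U) :
    ∀ l : List (Fin n), AnalyticOnNhd ℂ (corr F₀ l) U
  | [] => hF
  | α :: l => (analyticOnNhd_corr hF l).pd α

/-- Adjacent transpositions suffice, and these are equality of mixed partials. The equality is kept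
on an open set so that it can be differentiated in the `cons` case. -/
theorem corr_perm (hU : IsOpen U) (hF : AnalyticOnNhd ℂ F₀ U) {l l' : List (Fin n)}
    (h : l.Perm l') : Set.EqOn (corr F₀ l) (corr F₀ l') U := by
  induction h with
  | nil => exact fun _ _ => rfl
  | cons a _ ih => exact fun t ht => pd_congr_of_eqOn hU ih ht
  | swap a b l => exact fun t ht => pd_comm (analyticOnNhd_corr hF l t ht)
  | trans _ _ h₁ h₂ => exact h₁.trans h₂

end Correlators

open Matrix in
/-- A bilinear form with a symmetric matrix is symmetric. -/
theorem dotProduct_mulVec_comm_of_isSymm {ι : Type*} [Fintype ι] {A : Matrix ι ι ℂ}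
    (hA : A.IsSymm) (x y : ι → ℂ) : x ⬝ᵥ A *ᵥ y = y ⬝ᵥ A *ᵥ x := by
  rw [dotProduct_mulVec, ← mulVec_transpose, hA.eq, dotProduct_comm]

/-- The gradient of a function of `n` complex variables, as a vector of partial derivatives. -/
noncomputable def gradVec {n : ℕ} (f : (Fin n → ℂ) → ℂ) (x : Fin n → ℂ) : Fin n → ℂ :=
  fun μ => pd μ f x

/-! ### Algebra of the product; gradients of the two-point functions. -/

namespace FrobeniusManifold

open Matrix

variable {n : ℕ} [NeZero n] (X : FrobeniusManifold n) {v : Fin n → ℂ}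

/-- The matrix `(c_{ξαβ})_{αβ}` of third derivatives of the potential. -/
noncomputable def cubic (ξ : Fin n) (v : Fin n → ℂ) : Matrix (Fin n) (Fin n) ℂ :=
  Matrix.of fun α β => thirdDeriv X.potential ξ α β v

theorem thirdDeriv_swap_left (hv : v ∈ X.domain) (α β γ : Fin n) :
    thirdDeriv X.potential α β γ v = thirdDeriv X.potential β α γ v :=
  pd_comm ((X.analytic_potential.pd γ) v hv)

theorem thirdDeriv_swap_right (hv : v ∈ X.domain) (α β γ : Fin n) :
    thirdDeriv X.potential α β γ v = thirdDeriv X.potential α γ β v :=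
  pd_congr_of_eqOn X.isOpen_domain (fun _ hw => pd_comm (X.analytic_potential _ hw)) hv

theorem cubic_isSymm (hv : v ∈ X.domain) (ξ : Fin n) : (X.cubic ξ v).IsSymm :=
  Matrix.ext fun α β => X.thirdDeriv_swap_right hv ξ β α

theorem cubic_swap (hv : v ∈ X.domain) (α β γ : Fin n) :
    X.cubic α v β γ = X.cubic β v α γ := X.thirdDeriv_swap_left hv α β γ

theorem cubic_zero (hv : v ∈ X.domain) : X.cubic 0 v = X.eta :=
  Matrix.ext fun α β => X.eta_eq v hv α β

theorem eta_inv_isSymm : (X.eta⁻¹).IsSymm := by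
  rw [Matrix.IsSymm, transpose_nonsing_inv, X.eta_symm.eq]

theorem eta_mul_inv : X.eta * X.eta⁻¹ = 1 := mul_nonsing_inv _ X.eta_nondeg

theorem eta_inv_mul : X.eta⁻¹ * X.eta = 1 := nonsing_inv_mul _ X.eta_nondeg

theorem structConst_eq (hv : v ∈ X.domain) (γ α β : Fin n) :
    structConst X.potential X.eta γ α β v = (X.eta⁻¹ * X.cubic α v) γ β := by
  rw [mul_apply]
  exact Finset.sum_congr rfl fun δ _ => by rw [X.thirdDeriv_swap_right hv]; rfl

theorem gradPair_eq (f g : (Fin n → ℂ) → ℂ) (v : Fin n → ℂ) :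
    X.gradPair f g v = gradVec f v ⬝ᵥ X.eta⁻¹ *ᵥ gradVec g v := by
  simp only [gradPair, dotProduct, mulVec, gradVec, Finset.mul_sum]
  exact Finset.sum_congr rfl fun _ _ => Finset.sum_congr rfl fun _ _ => by ring

theorem gradPair_comm (f g : (Fin n → ℂ) → ℂ) (v : Fin n → ℂ) :
    X.gradPair f g v = X.gradPair g f v := by
  rw [gradPair_eq, gradPair_eq, dotProduct_mulVec_comm_of_isSymm X.eta_inv_isSymm]

/-- The contraction `c_ξ^{μν} ∂_μ f ∂_ν g`. -/
noncomputable def cubicPair (ξ : Fin n) (f g : (Fin n → ℂ) → ℂ) (v : Fin n → ℂ) : ℂ :=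
  gradVec f v ⬝ᵥ (X.eta⁻¹ * X.cubic ξ v * X.eta⁻¹) *ᵥ gradVec g v

variable {X} in
theorem analyticOnNhd_gradPair {f g : (Fin n → ℂ) → ℂ} {U : Set (Fin n → ℂ)}
    (hf : AnalyticOnNhd ℂ f U) (hg : AnalyticOnNhd ℂ g U) :
    AnalyticOnNhd ℂ (X.gradPair f g) U := fun v hv =>
  Finset.analyticAt_fun_sum _ fun μ _ => Finset.analyticAt_fun_sum _ fun ν _ =>
    (analyticAt_const.mul (hf.pd μ v hv)).mul (hg.pd ν v hv)

theorem pd_gradPair {f g : (Fin n → ℂ) → ℂ} (hf : AnalyticAt ℂ f v) (hg : AnalyticAt ℂ g v)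
    (ξ : Fin n) :
    pd ξ (X.gradPair f g) v =
      (fun μ => pd ξ (pd μ f) v) ⬝ᵥ X.eta⁻¹ *ᵥ gradVec g v +
        gradVec f v ⬝ᵥ X.eta⁻¹ *ᵥ fun μ => pd ξ (pd μ g) v := by
  have ha : ∀ μ ν, AnalyticAt ℂ (fun v => X.eta⁻¹ μ ν * pd μ f v) v := fun μ ν =>
    analyticAt_const.mul (hf.pd μ)
  have hb : ∀ μ ν, AnalyticAt ℂ (fun v => X.eta⁻¹ μ ν * pd μ f v * pd ν g v) v :=
    fun μ ν => (ha μ ν).mul (hg.pd ν)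
  have h1 : pd ξ (X.gradPair f g) v =
      ∑ μ, ∑ ν, (X.eta⁻¹ μ ν * pd ξ (pd μ f) v * pd ν g v
        + X.eta⁻¹ μ ν * pd μ f v * pd ξ (pd ν g) v) := by
    unfold gradPair
    rw [pd_sum _ fun μ _ => Finset.analyticAt_fun_sum _ fun ν _ => hb μ ν]
    refine Finset.sum_congr rfl fun μ _ => ?_
    rw [pd_sum _ fun ν _ => hb μ ν]
    refine Finset.sum_congr rfl fun ν _ => ?_
    rw [pd_mul (ha μ ν) (hg.pd ν), pd_const_mul _ (hf.pd μ)]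
  rw [h1]
  simp only [dotProduct, mulVec, gradVec, Finset.mul_sum, ← Finset.sum_add_distrib]
  exact Finset.sum_congr rfl fun _ _ => Finset.sum_congr rfl fun _ _ => by ring

namespace Calibration

variable {X} (Θ : X.Calibration)

theorem pd_theta_zero (hv : v ∈ X.domain) (α β : Fin n) :
    pd β (Θ.theta α 0) v = X.eta α β := by
  have hc : ∀ γ, AnalyticAt ℂ (fun w : Fin n → ℂ => w γ) v := fun γ => analyticAt_id.coord γ
  have hm : ∀ γ, AnalyticAt ℂ (fun w : Fin n → ℂ => X.eta α γ * w γ) v := fun γ =>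
    analyticAt_const.mul (hc γ)
  rw [pd_congr_of_eqOn X.isOpen_domain (fun w hw => Θ.theta_zero w hw α) hv,
    pd_sum _ fun γ _ => hm γ]
  simp_rw [pd_const_mul _ (hc _), pd_coord]
  simp

theorem gradVec_theta_zero (hv : v ∈ X.domain) (α : Fin n) :
    gradVec (Θ.theta α 0) v = X.eta *ᵥ Pi.single α 1 := by
  rw [mulVec_single_one]
  exact funext fun β => (Θ.pd_theta_zero hv α β).trans (X.eta_symm.apply β α)

theorem pd_pd_theta_zero (hv : v ∈ X.domain) (α β γ : Fin n) :
    pd γ (pd β (Θ.theta α 0)) v = 0 := by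
  rw [pd_congr_of_eqOn X.isOpen_domain (fun w hw => Θ.pd_theta_zero hw α β) hv, pd_const]

theorem pd_gradVec_theta_succ (hv : v ∈ X.domain) (ξ γ : Fin n) (p : ℕ) :
    (fun μ => pd ξ (pd μ (Θ.theta γ (p + 1))) v) =
      (X.cubic ξ v * X.eta⁻¹) *ᵥ gradVec (Θ.theta γ p) v := by
  have h : X.cubic ξ v * X.eta⁻¹ = (X.eta⁻¹ * X.cubic ξ v)ᵀ := by
    rw [transpose_mul, X.eta_inv_isSymm.eq, (X.cubic_isSymm hv ξ).eq]
  funext μ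
  rw [Θ.theta_succ v hv, h]
  exact Finset.sum_congr rfl fun κ _ => by rw [X.structConst_eq hv]; rfl

theorem twoPoint_zero_right (α : Fin n) (p : ℕ) (β : Fin n) :
    Θ.twoPoint α p β 0 = X.gradPair (Θ.theta α (p + 1)) (Θ.theta β 0) := by
  funext v
  simp [twoPoint]

/-- The coefficient form of `(z + w) Ω(z, w) = ⟨∇θ(z), ∇θ(w)⟩ - η`; it drives the inductions on `q`.
-/
theorem twoPoint_succ_right (α : Fin n) (p : ℕ) (β : Fin n) (q : ℕ) :
    Θ.twoPoint α p β (q + 1) = fun v =>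
      X.gradPair (Θ.theta α (p + 1)) (Θ.theta β (q + 1)) v - Θ.twoPoint α (p + 1) β q v := by
  funext v
  rw [twoPoint, Finset.sum_range_succ', twoPoint, sub_eq_neg_add, ← Finset.sum_neg_distrib]
  congr 1
  · refine Finset.sum_congr rfl fun m _ => ?_
    rw [show p + (m + 1) + 1 = p + 1 + m + 1 by ring, Nat.add_sub_add_right, pow_succ]
    ring
  · simp

theorem analyticOnNhd_twoPoint (α : Fin n) (p : ℕ) (β : Fin n) (q : ℕ) :
    AnalyticOnNhd ℂ (Θ.twoPoint α p β q) X.domain := fun v hv =>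
  Finset.analyticAt_fun_sum _ fun _ _ => analyticAt_const.mul
    (analyticOnNhd_gradPair (Θ.analytic_theta _ _) (Θ.analytic_theta _ _) v hv)

/-- The defining sum treats its two arguments differently; the orthogonality of the calibration
restores the symmetry. -/
theorem twoPoint_comm (hv : v ∈ X.domain) (α : Fin n) (p : ℕ) (β : Fin n) (q : ℕ) :
    Θ.twoPoint α p β q v = Θ.twoPoint β q α p v := by
  induction q generalizing p with
  | zero =>
    have h := Θ.theta_orth v hv β α (p + 1)
    -- In the vanishing coefficient of order `p + 1` the term `m = 0` is `Ω_{α,p;β,0}`, and the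
    -- other terms add up to `-Ω_{β,0;α,p}`.
    rw [Finset.sum_range_succ', if_neg (Nat.succ_ne_zero p)] at h
    rw [twoPoint_zero_right, gradPair_comm, twoPoint]
    simp only [pow_zero, one_mul, Nat.sub_zero] at h
    rw [eq_neg_of_add_eq_zero_right h, ← Finset.sum_neg_distrib]
    refine Finset.sum_congr rfl fun m _ => ?_
    rw [zero_add, Nat.add_sub_add_right, pow_succ]
    ring
  | succ q ih =>
    rw [congrFun (Θ.twoPoint_succ_right α p β q) v, ih, gradPair_comm]
    have h := congrFun (Θ.twoPoint_succ_right β q α p) v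
    rw [h]
    ring

/-- Only one term survives, because `θ_{β,0}` is linear in the flat coordinates. -/
theorem pd_gradPair_zero (hv : v ∈ X.domain) (ξ α β : Fin n) (p : ℕ) :
    pd ξ (X.gradPair (Θ.theta α (p + 1)) (Θ.theta β 0)) v =
      X.cubicPair ξ (Θ.theta α p) (Θ.theta β 0) v := by
  rw [X.pd_gradPair (Θ.analytic_theta _ _ v hv) (Θ.analytic_theta _ _ v hv),
    Θ.pd_gradVec_theta_succ hv]
  simp only [Θ.pd_pd_theta_zero hv]
  rw [show (fun _ : Fin n => (0 : ℂ)) = 0 from rfl, mulVec_zero, dotProduct_zero, add_zero,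
    cubicPair, dotProduct_comm, dotProduct_mulVec, dotProduct_comm, ← mulVec_transpose,
    mulVec_mulVec, transpose_mul, X.eta_inv_isSymm.eq, (X.cubic_isSymm hv ξ).eq]

theorem pd_gradPair_succ (hv : v ∈ X.domain) (ξ α β : Fin n) (p q : ℕ) :
    pd ξ (X.gradPair (Θ.theta α (p + 1)) (Θ.theta β (q + 1))) v =
      X.cubicPair ξ (Θ.theta α p) (Θ.theta β (q + 1)) v +
        X.cubicPair ξ (Θ.theta α (p + 1)) (Θ.theta β q) v := by
  rw [X.pd_gradPair (Θ.analytic_theta _ _ v hv) (Θ.analytic_theta _ _ v hv),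
    Θ.pd_gradVec_theta_succ hv, Θ.pd_gradVec_theta_succ hv]
  congr 1
  · rw [cubicPair, dotProduct_comm, dotProduct_mulVec, dotProduct_comm, ← mulVec_transpose,
      mulVec_mulVec, transpose_mul, X.eta_inv_isSymm.eq, (X.cubic_isSymm hv ξ).eq]
  · rw [cubicPair, mulVec_mulVec, Matrix.mul_assoc]

/-- Differentiating `⟨∇θ_α(z), ∇θ_β(w)⟩` produces the factor `z + w`, which cancels the denominator
of the generating series; in the induction this is the cancellation of the second summand. -/
theorem pd_twoPoint (hv : v ∈ X.domain) (ξ α : Fin n) (p : ℕ) (β : Fin n) (q : ℕ) :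
    pd ξ (Θ.twoPoint α p β q) v = X.cubicPair ξ (Θ.theta α p) (Θ.theta β q) v := by
  induction q generalizing p with
  | zero => rw [twoPoint_zero_right, Θ.pd_gradPair_zero hv]
  | succ q ih =>
    rw [twoPoint_succ_right, pd_sub _ (Θ.analyticOnNhd_twoPoint _ _ _ _ v hv), ih,
      Θ.pd_gradPair_succ hv, add_sub_cancel_right]
    exact analyticOnNhd_gradPair (Θ.analytic_theta _ _) (Θ.analytic_theta _ _) v hv

theorem cubicPair_theta_zero (hv : v ∈ X.domain) (ξ α β : Fin n) :
    X.cubicPair ξ (Θ.theta α 0) (Θ.theta β 0) v = X.cubic ξ v α β := by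
  rw [cubicPair, Θ.gradVec_theta_zero hv, Θ.gradVec_theta_zero hv, mulVec_mulVec,
    Matrix.mul_assoc, X.eta_inv_mul, mul_one, dotProduct_comm, dotProduct_mulVec,
    ← mulVec_transpose, mulVec_mulVec, X.eta_symm.eq, ← Matrix.mul_assoc, X.eta_mul_inv, one_mul]
  simp

end Calibration

end FrobeniusManifold

/-! ### Derivatives of the free energy; invertibility of `M`. -/

namespace FrobeniusManifold

open Matrix

/-- The indices `(p, α)` of the times that are allowed to be nonzero. -/
def timeIndices (n N : ℕ) : Finset (ℕ × Fin n) := Finset.range (N + 1) ×ˢ Finset.univ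

theorem sum_ite_timeIndices {n N : ℕ} (γ : Fin n) (f : ℕ × Fin n → ℂ) :
    ∑ i ∈ timeIndices n N, (if i = (0, γ) then 1 else 0) * f i = f (0, γ) := by
  simp [timeIndices]

variable {n : ℕ} [NeZero n] {X : FrobeniusManifold n} {Θ : X.Calibration} {N : ℕ}
  {s : ℕ → Fin n → ℂ} {U : Set (Fin n → ℂ)} {v : (Fin n → ℂ) → (Fin n → ℂ)} {t : Fin n → ℂ}

theorem analyticAt_shiftedTime (s : ℕ → Fin n → ℂ) (p : ℕ) (α : Fin n) (t : Fin n → ℂ) :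
    AnalyticAt ℂ (fun t => shiftedTime s t p α) t := by
  unfold shiftedTime
  by_cases hp : p = 0
  · simp only [hp, if_true]
    exact (analyticAt_id.coord α).sub analyticAt_const
  · simp only [hp, if_false]
    exact analyticAt_const

theorem pd_shiftedTime (s : ℕ → Fin n → ℂ) (γ : Fin n) (p : ℕ) (α : Fin n) (t : Fin n → ℂ) :
    pd γ (fun t => shiftedTime s t p α) t = if (p, α) = (0, γ) then 1 else 0 := by
  have hc : AnalyticAt ℂ (fun t : Fin n → ℂ => t α) t := analyticAt_id.coord α
  unfold shiftedTime
  by_cases hp : p = 0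
  · simp only [hp, if_true]
    rw [pd_sub hc analyticAt_const, pd_coord, pd_const]
    simp [eq_comm]
  · simp only [hp, if_false]
    rw [pd_const]
    simp [hp]

theorem Calibration.freeEnergy_eq (t : Fin n → ℂ) :
    Θ.freeEnergy N s v t = 1 / 2 * ∑ i ∈ timeIndices n N, ∑ j ∈ timeIndices n N,
      shiftedTime s t i.1 i.2 * shiftedTime s t j.1 j.2 * Θ.twoPoint i.2 i.1 j.2 j.1 (v t) := by
  simp only [Calibration.freeEnergy, timeIndices, Finset.sum_product]
  congr 1
  exact Finset.sum_congr rfl fun p _ => Finset.sum_comm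

namespace IsTopologicalSolution

theorem sum_gradVec (hv : X.IsTopologicalSolution Θ N s U v) (ht : t ∈ U) :
    ∑ i ∈ timeIndices n N, shiftedTime s t i.1 i.2 • gradVec (Θ.theta i.2 i.1) (v t) = 0 := by
  funext β
  rw [Finset.sum_apply, timeIndices, Finset.sum_product]
  exact hv.eulerLagrange t ht β

/-- The Euler-Lagrange equation inserted into a linear slot. -/
theorem sum_cubicPair (hv : X.IsTopologicalSolution Θ N s U v) (ht : t ∈ U) (ξ : Fin n)
    (f : (Fin n → ℂ) → ℂ) :
    ∑ i ∈ timeIndices n N,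
      shiftedTime s t i.1 i.2 * X.cubicPair ξ f (Θ.theta i.2 i.1) (v t) = 0 := by
  simp only [cubicPair]
  simp_rw [← smul_eq_mul, ← dotProduct_smul, ← mulVec_smul, ← dotProduct_sum, ← mulVec_sum,
    hv.sum_gradVec ht]
  simp

theorem analyticAt_twoPoint_comp (hv : X.IsTopologicalSolution Θ N s U v) (ht : t ∈ U)
    (α : Fin n) (p : ℕ) (β : Fin n) (q : ℕ) :
    AnalyticAt ℂ (fun t => Θ.twoPoint α p β q (v t)) t :=
  (Θ.analyticOnNhd_twoPoint α p β q (v t) (hv.mapsTo ht)).comp (hv.analytic t ht)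

theorem pd_twoPoint_comp (hv : X.IsTopologicalSolution Θ N s U v) (ht : t ∈ U) (γ : Fin n)
    (α : Fin n) (p : ℕ) (β : Fin n) (q : ℕ) :
    pd γ (fun t => Θ.twoPoint α p β q (v t)) t =
      ∑ ξ, X.cubicPair ξ (Θ.theta α p) (Θ.theta β q) (v t) * pd γ (fun t => v t ξ) t := by
  rw [pd_comp (Θ.analyticOnNhd_twoPoint α p β q (v t) (hv.mapsTo ht)) (hv.analytic t ht)]
  simp_rw [Θ.pd_twoPoint (hv.mapsTo ht)]

theorem analyticOnNhd_freeEnergy (hv : X.IsTopologicalSolution Θ N s U v) :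
    AnalyticOnNhd ℂ (Θ.freeEnergy N s v) U := fun t ht =>
  analyticAt_const.mul <| Finset.analyticAt_fun_sum _ fun _ _ =>
    Finset.analyticAt_fun_sum _ fun _ _ => Finset.analyticAt_fun_sum _ fun _ _ =>
      Finset.analyticAt_fun_sum _ fun _ _ =>
        ((analyticAt_shiftedTime s _ _ t).mul (analyticAt_shiftedTime s _ _ t)).mul
          (hv.analyticAt_twoPoint_comp ht _ _ _ _)

/-- Along a topological solution a combination of two-point functions with the shifted times as
coefficients depends on the primary times only through these coefficients. -/
theorem sum_mul_pd_twoPoint_comp (hv : X.IsTopologicalSolution Θ N s U v) (ht : t ∈ U)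
    (γ α : Fin n) (p : ℕ) :
    ∑ j ∈ timeIndices n N, shiftedTime s t j.1 j.2 *
      pd γ (fun t => Θ.twoPoint α p j.2 j.1 (v t)) t = 0 := by
  simp_rw [hv.pd_twoPoint_comp ht, Finset.mul_sum]
  rw [Finset.sum_comm]
  refine Finset.sum_eq_zero fun ξ _ => ?_
  simp_rw [← mul_assoc]
  rw [← Finset.sum_mul, hv.sum_cubicPair ht, zero_mul]

/-- The derivative of `Ω` contributes nothing by `sum_mul_pd_twoPoint_comp`. The two shifted-time
factors contribute equally by the symmetry of `Ω`, which absorbs the factor `1/2`. -/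
theorem pd_freeEnergy (hv : X.IsTopologicalSolution Θ N s U v) (ht : t ∈ U) (γ : Fin n) :
    pd γ (Θ.freeEnergy N s v) t =
      ∑ j ∈ timeIndices n N, shiftedTime s t j.1 j.2 * Θ.twoPoint γ 0 j.2 j.1 (v t) := by
  have hτ := fun (i : ℕ × Fin n) => analyticAt_shiftedTime s i.1 i.2 t
  have hΩ := fun (i j : ℕ × Fin n) => hv.analyticAt_twoPoint_comp ht i.2 i.1 j.2 j.1
  have hij := fun (i j : ℕ × Fin n) => ((hτ i).fun_mul (hτ j)).fun_mul (hΩ i j)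
  have h1 : pd γ (Θ.freeEnergy N s v) t = 1 / 2 * ∑ i ∈ timeIndices n N, ∑ j ∈ timeIndices n N,
      ((if i = (0, γ) then 1 else 0) *
          (shiftedTime s t j.1 j.2 * Θ.twoPoint i.2 i.1 j.2 j.1 (v t))
        + (if j = (0, γ) then 1 else 0) *
          (shiftedTime s t i.1 i.2 * Θ.twoPoint i.2 i.1 j.2 j.1 (v t))
        + shiftedTime s t i.1 i.2 * (shiftedTime s t j.1 j.2 *
          pd γ (fun t => Θ.twoPoint i.2 i.1 j.2 j.1 (v t)) t)) := by
    rw [pd_congr_of_eventuallyEq (Filter.Eventually.of_forall Θ.freeEnergy_eq), pd_const_mul _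
      (Finset.analyticAt_fun_sum _ fun i _ => Finset.analyticAt_fun_sum _ fun j _ => hij i j),
      pd_sum _ fun i _ => Finset.analyticAt_fun_sum _ fun j _ => hij i j]
    congr 1
    refine Finset.sum_congr rfl fun i _ => ?_
    rw [pd_sum _ fun j _ => hij i j]
    refine Finset.sum_congr rfl fun j _ => ?_
    rw [pd_mul ((hτ i).fun_mul (hτ j)) (hΩ i j), pd_mul (hτ i) (hτ j), pd_shiftedTime,
      pd_shiftedTime]
    ring
  simp_rw [h1, Finset.sum_add_distrib, ← Finset.mul_sum, hv.sum_mul_pd_twoPoint_comp ht,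
    mul_zero, Finset.sum_const_zero, add_zero, sum_ite_timeIndices]
  simp_rw [fun i : ℕ × Fin n => Θ.twoPoint_comm (hv.mapsTo ht) i.2 i.1 γ 0]
  ring

theorem pd_pd_freeEnergy (hv : X.IsTopologicalSolution Θ N s U v) (ht : t ∈ U) (γ α : Fin n) :
    pd γ (pd α (Θ.freeEnergy N s v)) t = Θ.twoPoint α 0 γ 0 (v t) := by
  have hj := fun (j : ℕ × Fin n) => (analyticAt_shiftedTime s j.1 j.2 t).fun_mul
    (hv.analyticAt_twoPoint_comp ht α 0 j.2 j.1)
  rw [pd_congr_of_eqOn hv.isOpen (fun _ ht => hv.pd_freeEnergy ht α) ht,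
    pd_sum _ fun j _ => hj j]
  have h : ∀ j : ℕ × Fin n,
      pd γ (fun t => shiftedTime s t j.1 j.2 * Θ.twoPoint α 0 j.2 j.1 (v t)) t =
      (if j = (0, γ) then 1 else 0) * Θ.twoPoint α 0 j.2 j.1 (v t) + shiftedTime s t j.1 j.2 *
        pd γ (fun t => Θ.twoPoint α 0 j.2 j.1 (v t)) t := fun j => by
    rw [pd_mul (analyticAt_shiftedTime s j.1 j.2 t) (hv.analyticAt_twoPoint_comp ht α 0 j.2 j.1),
      pd_shiftedTime]
  simp_rw [h, Finset.sum_add_distrib, hv.sum_mul_pd_twoPoint_comp ht, add_zero]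
  exact sum_ite_timeIndices γ fun j => Θ.twoPoint α 0 j.2 j.1 (v t)

/-- The third derivatives of the free energy: `∂_δ ∂_γ ∂_α 𝓕₀ = c_{ξγα}(v) ∂_δ v^ξ`. -/
theorem corr_three (hv : X.IsTopologicalSolution Θ N s U v) (ht : t ∈ U) (δ γ α : Fin n) :
    corr (Θ.freeEnergy N s v) [δ, γ, α] t =
      ∑ ξ, X.cubic ξ (v t) γ α * pd δ (fun t => v t ξ) t := by
  have h : corr (Θ.freeEnergy N s v) [δ, γ, α] t =
      pd δ (pd γ (pd α (Θ.freeEnergy N s v))) t := rfl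
  rw [h, pd_congr_of_eqOn hv.isOpen (fun _ ht => hv.pd_pd_freeEnergy ht γ α) ht,
    hv.pd_twoPoint_comp ht]
  simp_rw [Θ.cubicPair_theta_zero (hv.mapsTo ht)]
  exact Finset.sum_congr rfl fun ξ _ => by rw [(X.cubic_isSymm (hv.mapsTo ht) ξ).apply]

/-- The Jacobian matrix `(∂_α v^ξ)` of a topological solution. -/
noncomputable def _root_.jacobian (v : (Fin n → ℂ) → (Fin n → ℂ)) (t : Fin n → ℂ) :
    Matrix (Fin n) (Fin n) ℂ :=
  Matrix.of fun α ξ => pd α (fun t => v t ξ) t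

/-- Once the index of the unit is moved into the tensor `c`, the latter becomes `η`. -/
theorem corrMatrix_eq (hv : X.IsTopologicalSolution Θ N s U v) (ht : t ∈ U) :
    corrMatrix (Θ.freeEnergy N s v) t = jacobian v t * X.eta := by
  ext α β
  have h : corrMatrix (Θ.freeEnergy N s v) t α β = corr (Θ.freeEnergy N s v) [0, α, β] t := rfl
  rw [h, corr_perm hv.isOpen hv.analyticOnNhd_freeEnergy (List.Perm.swap α 0 [β]) ht,
    hv.corr_three ht, mul_apply]
  refine Finset.sum_congr rfl fun ξ _ => ?_
  rw [X.cubic_swap (hv.mapsTo ht), X.cubic_zero (hv.mapsTo ht), mul_comm]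
  rfl

/-- The derivative of the Euler-Lagrange equation. -/
theorem jacobian_mul (hv : X.IsTopologicalSolution Θ N s U v) (ht : t ∈ U) :
    jacobian v t * (Matrix.of fun ξ β => ∑ i ∈ timeIndices n N,
      shiftedTime s t i.1 i.2 * pd ξ (pd β (Θ.theta i.2 i.1)) (v t)) = -X.eta := by
  ext γ β
  have hθ := fun (i : ℕ × Fin n) => (Θ.analytic_theta i.2 i.1).pd β (v t) (hv.mapsTo ht)
  have hθ' : ∀ i : ℕ × Fin n, AnalyticAt ℂ (fun t => pd β (Θ.theta i.2 i.1) (v t)) t :=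
    fun i => (hθ i).comp (hv.analytic t ht)
  have hτ := fun (i : ℕ × Fin n) => analyticAt_shiftedTime s i.1 i.2 t
  have h0 : pd γ (fun t => ∑ i ∈ timeIndices n N,
      shiftedTime s t i.1 i.2 * pd β (Θ.theta i.2 i.1) (v t)) t = 0 := by
    rw [pd_congr_of_eqOn (g := fun _ => 0) hv.isOpen (fun t ht => ?_) ht, pd_const]
    simpa [gradVec] using congrFun (hv.sum_gradVec ht) β
  rw [pd_sum _ fun i _ => (hτ i).fun_mul (hθ' i)] at h0
  simp_rw [pd_mul (hτ _) (hθ' _), pd_shiftedTime, pd_comp (hθ _) (hv.analytic t ht)] at h0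
  rw [Finset.sum_add_distrib,
    sum_ite_timeIndices γ fun i => pd β (Θ.theta i.2 i.1) (v t),
    Θ.pd_theta_zero (hv.mapsTo ht)] at h0
  rw [neg_apply, eq_neg_iff_add_eq_zero, add_comm, ← h0, mul_apply]
  congr 1
  simp_rw [Matrix.of_apply, Finset.mul_sum]
  rw [Finset.sum_comm]
  refine Finset.sum_congr rfl fun i _ => Finset.sum_congr rfl fun ξ _ => ?_
  simp only [jacobian, Matrix.of_apply]
  ring

/-- By `jacobian_mul` the determinant of the Jacobian divides `det (-η)`, a unit. -/
theorem isUnit_det_corrMatrix (hv : X.IsTopologicalSolution Θ N s U v) (ht : t ∈ U) :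
    IsUnit (corrMatrix (Θ.freeEnergy N s v) t).det := by
  have h := congrArg Matrix.det (hv.jacobian_mul ht)
  have hη : IsUnit (-X.eta).det := by
    rw [det_neg]
    exact (isUnit_one.neg.pow _).mul X.eta_nondeg
  rw [hv.corrMatrix_eq ht, det_mul]
  refine IsUnit.mul ?_ X.eta_nondeg
  rw [← h, det_mul] at hη
  exact isUnit_of_mul_isUnit_left hη

end IsTopologicalSolution

end FrobeniusManifold

/-! ### Analyticity and derivative of a matrix inverse. -/

section MatrixInverse

open Matrix

variable {n : ℕ} {ι : Type*} [Fintype ι] [DecidableEq ι] {A : (Fin n → ℂ) → Matrix ι ι ℂ}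
  {x : Fin n → ℂ}

theorem analyticAt_det (hA : ∀ a b, AnalyticAt ℂ (fun y => A y a b) x) :
    AnalyticAt ℂ (fun y => (A y).det) x := by
  simp only [det_apply']
  exact Finset.analyticAt_fun_sum _ fun σ _ => analyticAt_const.mul
    (Finset.analyticAt_fun_prod _ fun a _ => hA _ _)

/-- Cramer's rule: the entries are cofactors divided by a nonvanishing determinant. -/
theorem analyticAt_inv_apply (hA : ∀ a b, AnalyticAt ℂ (fun y => A y a b) x)
    (hx : IsUnit (A x).det) (a b : ι) : AnalyticAt ℂ (fun y => (A y)⁻¹ a b) x := by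
  simp only [inv_def, Matrix.smul_apply, smul_eq_mul, Ring.inverse_eq_inv', adjugate_apply]
  refine ((analyticAt_det hA).fun_inv hx.ne_zero).fun_mul (analyticAt_det fun c d => ?_)
  by_cases hc : c = b
  · subst hc
    simpa only [updateRow_self] using analyticAt_const
  · simpa only [updateRow_ne hc] using hA c d

/-- The derivative of the inverse of a matrix: `∂(A⁻¹) = -A⁻¹ (∂A) A⁻¹`. -/
theorem pd_inv_apply (hA : ∀ a b, AnalyticAt ℂ (fun y => A y a b) x)
    (hx : IsUnit (A x).det) (i : Fin n) (a b : ι) :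
    pd i (fun y => (A y)⁻¹ a b) x =
      -((A x)⁻¹ * (Matrix.of fun c d => pd i (fun y => A y c d) x) * (A x)⁻¹) a b := by
  have hI := analyticAt_inv_apply hA hx
  have hU : ∀ᶠ y in nhds x, IsUnit (A y).det := by
    filter_upwards [(analyticAt_det hA).continuousAt.eventually_ne hx.ne_zero] with y hy
    exact hy.isUnit
  -- This is the derivative of `A⁻¹ A = 1`, an identity valid in a whole neighbourhood of `x`.
  have h : (Matrix.of fun c d => pd i (fun y => (A y)⁻¹ c d) x) * A x =
      -((A x)⁻¹ * Matrix.of fun c d => pd i (fun y => A y c d) x) := by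
    ext c d
    have h0 : pd i (fun y => ∑ k, (A y)⁻¹ c k * A y k d) x = 0 := by
      rw [pd_congr_of_eventuallyEq (g := fun _ => (1 : Matrix ι ι ℂ) c d) ?_, pd_const]
      filter_upwards [hU] with y hy
      rw [← Matrix.mul_apply, nonsing_inv_mul _ hy]
    rw [pd_sum _ fun k _ => (hI c k).fun_mul (hA k d)] at h0
    simp_rw [pd_mul (hI c _) (hA _ d), Finset.sum_add_distrib] at h0
    rw [Matrix.neg_apply, eq_neg_iff_add_eq_zero, Matrix.mul_apply, Matrix.mul_apply]
    exact h0
  rw [← Matrix.neg_apply, ← Matrix.neg_mul, ← h, Matrix.mul_assoc, mul_nonsing_inv _ hx, mul_one]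
  rfl

end MatrixInverse

/-- The correlation function of a multiset of indices. -/
noncomputable def multisetCorr {n : ℕ} (F₀ : (Fin n → ℂ) → ℂ) (m : Multiset (Fin n)) :
    (Fin n → ℂ) → ℂ :=
  corr F₀ m.toList

/-! ### Graph contractions, isomorphisms and subdivision of edges. -/

namespace DualGraph

open Matrix

section HalfEdges

variable {n k k' : ℕ}

/-- The labels that an edge with given ends and labels of its half-edges brings to a vertex. -/
def halfEdges (p : Fin k × Fin k) (c : Fin n × Fin n) (w : Fin k) : Multiset (Fin n) :=
  (if p.1 = w then {c.1} else 0) + (if p.2 = w then {c.2} else 0)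

theorem halfEdges_swap (p : Fin k × Fin k) (c : Fin n × Fin n) (w : Fin k) :
    halfEdges p.swap c.swap w = halfEdges p c w := add_comm _ _

theorem halfEdges_map (σ : Fin k ≃ Fin k') (p : Fin k × Fin k) (c : Fin n × Fin n)
    (w : Fin k) : halfEdges (Prod.map σ σ p) c (σ w) = halfEdges p c w := by
  simp [halfEdges]

/-- The exchange of the labels of the half-edges when a vertex is inserted into an edge. -/
def subdivideLabels {m : ℕ} (e₀ : Fin m) :
    ((Fin n × Fin n) × (Fin m → Fin n × Fin n)) ≃
      ((Fin n × Fin n) × (Fin m → Fin n × Fin n)) where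
  toFun p := (((p.2 e₀).2, p.1.1), Function.update p.2 e₀ ((p.2 e₀).1, p.1.2))
  invFun p := ((p.1.2, (p.2 e₀).2), Function.update p.2 e₀ ((p.2 e₀).1, p.1.1))
  left_inv p := by simp
  right_inv p := by simp

/-- The ends of the edges after a new vertex has been inserted into a given edge. -/
def subdivideEnds {m : ℕ} (ends : Fin m → Fin k × Fin k) (e₀ : Fin m) :
    Fin (m + 1) → Fin (k + 1) × Fin (k + 1) :=
  Fin.snoc (α := fun _ => Fin (k + 1) × Fin (k + 1))
    (fun e => ((ends e).1.castSucc, if e = e₀ then Fin.last k else (ends e).2.castSucc))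
    (Fin.last k, (ends e₀).2.castSucc)

/-- The numbers of legs after a new vertex with two legs has been added. -/
def subdivideLegs (legs : Fin k → ℕ) : Fin (k + 1) → ℕ :=
  Fin.snoc (α := fun _ => ℕ) legs 2

/-- Isomorphism of graphs given by the ends of their edges and their numbers of legs. -/
def Iso {m m' : ℕ} (ends : Fin m → Fin k × Fin k) (legs : Fin k → ℕ)
    (ends' : Fin m' → Fin k' × Fin k') (legs' : Fin k' → ℕ) : Prop :=
  ∃ σ : Fin k ≃ Fin k', (∀ w, legs' (σ w) = legs w) ∧
    ∃ ε : Fin m ≃ Fin m', ∀ e,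
      ends' (ε e) = Prod.map σ σ (ends e) ∨ ends' (ε e) = (Prod.map σ σ (ends e)).swap

end HalfEdges

variable {n : ℕ} [NeZero n] {k m k' m' : ℕ}

/-- The labels at a vertex, for given labels of the half-edges. -/
def labels (ends : Fin m → Fin k × Fin k) (legs : Fin k → ℕ) (c : Fin m → Fin n × Fin n)
    (w : Fin k) : Multiset (Fin n) :=
  Multiset.replicate (legs w) 0 + ∑ e, halfEdges (ends e) (c e) w

/-- The contraction of a graph with vertex tensors `C` and edge tensor `W`. -/
noncomputable def contract (ends : Fin m → Fin k × Fin k) (legs : Fin k → ℕ)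
    (W : Matrix (Fin n) (Fin n) ℂ) (C : Multiset (Fin n) → ℂ) : ℂ :=
  ∑ c : Fin m → Fin n × Fin n, (∏ e, W (c e).1 (c e).2) * ∏ w, C (labels ends legs c w)

/-- An isomorphism may reverse edges. The bijection `φ` of labellings swaps the two labels of each
reversed edge, and the symmetry of `W` makes this harmless. -/
theorem contract_eq_of_iso {ends : Fin m → Fin k × Fin k} {legs : Fin k → ℕ}
    {ends' : Fin m' → Fin k' × Fin k'} {legs' : Fin k' → ℕ} (h : Iso ends legs ends' legs')
    {W : Matrix (Fin n) (Fin n) ℂ} (hW : W.IsSymm) (C : Multiset (Fin n) → ℂ) :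
    contract ends legs W C = contract ends' legs' W C := by
  obtain ⟨σ, hσ, ε, hε⟩ := h
  let φ : (Fin m → Fin n × Fin n) ≃ (Fin m' → Fin n × Fin n) :=
    Equiv.piCongr ε fun e => if ends' (ε e) = Prod.map σ σ (ends e) then Equiv.refl _
      else Equiv.prodComm _ _
  have hφ : ∀ c e, φ c (ε e) =
      if ends' (ε e) = Prod.map σ σ (ends e) then c e else (c e).swap := fun c e => by
    rw [Equiv.piCongr_apply_apply]
    split_ifs <;> rfl
  refine Fintype.sum_equiv φ _ _ fun c => ?_
  congr 1
  · refine Fintype.prod_equiv ε _ _ fun e => ?_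
    rw [hφ]
    split_ifs
    · rfl
    · exact (hW.apply _ _).symm
  · refine Fintype.prod_equiv σ _ _ fun w => congrArg C ?_
    rw [labels, labels, hσ]
    congr 1
    refine Fintype.sum_equiv ε _ _ fun e => ?_
    rw [hφ]
    split_ifs with he
    · rw [he, halfEdges_map]
    · rw [(hε e).resolve_left he, halfEdges_swap, halfEdges_map]

variable (ends : Fin m → Fin k × Fin k) (legs : Fin k → ℕ) (W : Matrix (Fin n) (Fin n) ℂ)
  (C : Multiset (Fin n) → ℂ)

/-- The right-hand side is the shape in which the product rule delivers the derivative of the vertex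
`w₀`. -/
theorem contract_addLeg (w₀ : Fin k) :
    contract ends (Function.update legs w₀ (legs w₀ + 1)) W C =
      ∑ c : Fin m → Fin n × Fin n, (∏ e, W (c e).1 (c e).2) *
        ((∏ w ∈ Finset.univ.erase w₀, C (labels ends legs c w)) *
          C (0 ::ₘ labels ends legs c w₀)) := by
  refine Finset.sum_congr rfl fun c _ => ?_
  congr 1
  have h : ∀ w, labels ends (Function.update legs w₀ (legs w₀ + 1)) c w =
      if w = w₀ then 0 ::ₘ labels ends legs c w₀ else labels ends legs c w := fun w => by
    by_cases hw : w = w₀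
    · subst hw
      simp [labels]
    · simp only [labels, Function.update_of_ne hw, if_neg hw]
  rw [← Finset.prod_erase_mul _ _ (Finset.mem_univ w₀), h w₀, if_pos rfl]
  congr 1
  refine Finset.prod_congr rfl fun w hw => ?_
  rw [h, if_neg (Finset.ne_of_mem_erase hw)]

/-- At the old vertices the two halves of `e₀` act as one edge: its first label comes from the old
edge, its second from the new one. -/
theorem labels_subdivide_castSucc (e₀ : Fin m) (c : Fin m → Fin n × Fin n) (x : Fin n × Fin n)
    (w : Fin k) :
    labels (subdivideEnds ends e₀) (subdivideLegs legs)
        (Fin.snoc (α := fun _ => Fin n × Fin n) c x) w.castSucc =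
      labels ends legs (Function.update c e₀ ((c e₀).1, x.2)) w := by
  simp only [labels, subdivideEnds, subdivideLegs, Fin.sum_univ_castSucc, Fin.snoc_castSucc,
    Fin.snoc_last]
  congr 1
  rw [← Finset.sum_erase_add _ _ (Finset.mem_univ e₀),
    ← Finset.sum_erase_add _ (fun e => halfEdges (ends e) _ w) (Finset.mem_univ e₀), add_assoc]
  congr 1
  · refine Finset.sum_congr rfl fun e he => ?_
    have he' := Finset.ne_of_mem_erase he
    simp [halfEdges, he']
  · have h : Fin.last k ≠ w.castSucc := (Fin.castSucc_lt_last w).ne'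
    simp [halfEdges, h]

theorem labels_subdivide_last (e₀ : Fin m) (c : Fin m → Fin n × Fin n) (x : Fin n × Fin n) :
    labels (subdivideEnds ends e₀) (subdivideLegs legs)
        (Fin.snoc (α := fun _ => Fin n × Fin n) c x) (Fin.last k) =
      {0, 0, (c e₀).2, x.1} := by
  have h : ∀ w : Fin k, w.castSucc ≠ Fin.last k := fun w => (Fin.castSucc_lt_last w).ne
  simp only [labels, subdivideEnds, subdivideLegs, Fin.sum_univ_castSucc, Fin.snoc_castSucc,
    Fin.snoc_last]
  rw [Finset.sum_eq_single e₀ (fun e _ he => by simp [halfEdges, he, h]) (by simp)]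
  simp only [halfEdges, h, Multiset.replicate_succ, Multiset.replicate_zero, if_true, if_false,
    add_zero, zero_add, Multiset.cons_add, Multiset.singleton_add]
  rw [Multiset.cons_swap _ 0, Multiset.cons_swap _ 0]
  rfl

/-- Summing over the two labels at the new vertex turns the edge tensor of `e₀` into `W C(0, 0, ·,
·) W`. With `W = M⁻¹` and the correlators as `C` this is `M⁻¹ (∂_x M) M⁻¹ = -∂_x M⁻¹`. -/
theorem contract_subdivide (e₀ : Fin m) :
    contract (subdivideEnds ends e₀) (subdivideLegs legs) W C =
      ∑ c : Fin m → Fin n × Fin n,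
        ((∏ e ∈ Finset.univ.erase e₀, W (c e).1 (c e).2) *
          (W * (Matrix.of fun a b => C {0, 0, a, b}) * W) (c e₀).1 (c e₀).2) *
            ∏ w, C (labels ends legs c w) := by
  have h1 : contract (subdivideEnds ends e₀) (subdivideLegs legs) W C =
      ∑ p : (Fin n × Fin n) × (Fin m → Fin n × Fin n),
        ((∏ e, W (p.2 e).1 (p.2 e).2) * W p.1.1 p.1.2) *
          ((∏ w, C (labels ends legs (Function.update p.2 e₀ ((p.2 e₀).1, p.1.2)) w)) *
            C {0, 0, (p.2 e₀).2, p.1.1}) := by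
    refine (Fintype.sum_equiv (Fin.snocEquiv fun _ => Fin n × Fin n) _ _ fun p => ?_).symm
    have hp : (Fin.snocEquiv (fun _ : Fin (m + 1) => Fin n × Fin n)) p =
        Fin.snoc (α := fun _ => Fin n × Fin n) p.2 p.1 := rfl
    rw [hp, Fin.prod_univ_castSucc, Fin.prod_univ_castSucc, labels_subdivide_last]
    simp only [Fin.snoc_castSucc, Fin.snoc_last, labels_subdivide_castSucc]
  -- Relabelling separates the pair of labels at the new vertex from a labelling of the original
  -- graph.
  rw [h1, Fintype.sum_equiv (subdivideLabels e₀) _ (fun p =>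
    ((∏ e ∈ Finset.univ.erase e₀, W (p.2 e).1 (p.2 e).2) *
      (W (p.2 e₀).1 p.1.1 * W p.1.2 (p.2 e₀).2)) *
        ((∏ w, C (labels ends legs p.2 w)) * C {0, 0, p.1.1, p.1.2})) fun p => ?_]
  · rw [Fintype.sum_prod_type_right]
    refine Finset.sum_congr rfl fun c _ => ?_
    simp only [Fintype.sum_prod_type, Matrix.mul_apply, Matrix.of_apply, Finset.sum_mul,
      Finset.mul_sum]
    rw [Finset.sum_comm]
    exact Finset.sum_congr rfl fun _ _ => Finset.sum_congr rfl fun _ _ => by ring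
  · rw [← Finset.prod_erase_mul _ _ (Finset.mem_univ e₀)]
    have h2 : ∀ e ∈ Finset.univ.erase e₀, W (((subdivideLabels e₀) p).2 e).1
        (((subdivideLabels e₀) p).2 e).2 = W (p.2 e).1 (p.2 e).2 := fun e he => by
      have he' := Finset.ne_of_mem_erase he
      simp [subdivideLabels, he']
    rw [Finset.prod_congr rfl h2]
    simp only [subdivideLabels, Equiv.coe_fn_mk, Function.update_self]
    ring

end DualGraph

/-! ### The derivative of a graph along `∂/∂t^{1,0}`. -/

namespace DualGraph

open Matrix

variable {n : ℕ} {F₀ : (Fin n → ℂ) → ℂ} {U : Set (Fin n → ℂ)} {t : Fin n → ℂ}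

/-- On `U` the order of the indices is irrelevant, so vertices can be labelled by multisets. -/
theorem corr_eq_multisetCorr (hU : IsOpen U) (hF : AnalyticOnNhd ℂ F₀ U) (ht : t ∈ U)
    (l : List (Fin n)) : corr F₀ l t = multisetCorr F₀ l t :=
  corr_perm hU hF (Multiset.coe_eq_coe.1 (Multiset.coe_toList (l : Multiset (Fin n)))).symm ht

theorem analyticOnNhd_multisetCorr (hF : AnalyticOnNhd ℂ F₀ U) (m : Multiset (Fin n)) :
    AnalyticOnNhd ℂ (multisetCorr F₀ m) U := analyticOnNhd_corr hF _

theorem pd_multisetCorr (hU : IsOpen U) (hF : AnalyticOnNhd ℂ F₀ U) (ht : t ∈ U)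
    (m : Multiset (Fin n)) (α : Fin n) :
    pd α (multisetCorr F₀ m) t = multisetCorr F₀ (α ::ₘ m) t := by
  have h := corr_eq_multisetCorr hU hF ht (α :: m.toList)
  rwa [← Multiset.cons_coe, Multiset.coe_toList] at h

variable [NeZero n]

theorem corrMatrix_isSymm (hU : IsOpen U) (hF : AnalyticOnNhd ℂ F₀ U) (ht : t ∈ U) :
    (corrMatrix F₀ t).IsSymm :=
  Matrix.ext fun α β => corr_perm hU hF ((List.Perm.swap α β []).cons 0) ht

theorem corrMatrix_inv_isSymm (hU : IsOpen U) (hF : AnalyticOnNhd ℂ F₀ U) (ht : t ∈ U) :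
    ((corrMatrix F₀ t)⁻¹).IsSymm := by
  rw [Matrix.IsSymm, transpose_nonsing_inv, (corrMatrix_isSymm hU hF ht).eq]

theorem coe_labels (Γ : DualGraph) (a b : Fin Γ.numEdges → Fin n) (w : Fin Γ.numVertices) :
    ((List.replicate (Γ.legs w) 0 ++ (List.finRange Γ.numEdges).flatMap fun e =>
      (if (Γ.ends e).1 = w then [a e] else []) ++
        (if (Γ.ends e).2 = w then [b e] else []) : List (Fin n)) : Multiset (Fin n)) =
      labels Γ.ends Γ.legs (fun e => (a e, b e)) w := by
  have h : ∀ (l : List (Fin Γ.numEdges)) (f : Fin Γ.numEdges → List (Fin n)),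
      ((l.flatMap f : List (Fin n)) : Multiset (Fin n)) =
        (l.map fun e => (f e : Multiset (Fin n))).sum := fun l f => by
    induction l with
    | nil => rfl
    | cons e l ih => rw [List.flatMap_cons, ← Multiset.coe_add, ih]; rfl
  rw [← Multiset.coe_add, Multiset.coe_replicate, h, labels, Fin.sum_univ_def]
  congr 3
  funext e
  rw [← Multiset.coe_add, halfEdges]
  congr 1 <;> split_ifs <;> rfl

theorem value_eq_contract (hU : IsOpen U) (hF : AnalyticOnNhd ℂ F₀ U) (ht : t ∈ U)
    (Γ : DualGraph) :
    Γ.value F₀ t = contract Γ.ends Γ.legs (corrMatrix F₀ t)⁻¹ fun m => multisetCorr F₀ m t := by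
  rw [value, ← Fintype.sum_prod_type', contract]
  refine (Fintype.sum_equiv (Equiv.arrowProdEquivProdArrow (Fin Γ.numEdges) (fun _ => Fin n)
    fun _ => Fin n) _ _ fun c => ?_).symm
  refine congrArg₂ _ rfl (Finset.prod_congr rfl fun w _ => ?_)
  rw [corr_eq_multisetCorr hU hF ht, coe_labels]
  rfl

theorem analyticAt_inv_corrMatrix (hF : AnalyticOnNhd ℂ F₀ U) (ht : t ∈ U)
    (hM : IsUnit (corrMatrix F₀ t).det) (a b : Fin n) :
    AnalyticAt ℂ (fun t => (corrMatrix F₀ t)⁻¹ a b) t :=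
  analyticAt_inv_apply (fun c d => analyticOnNhd_corr hF [0, c, d] t ht) hM a b

theorem pd_inv_corrMatrix (hU : IsOpen U) (hF : AnalyticOnNhd ℂ F₀ U) (ht : t ∈ U)
    (hM : IsUnit (corrMatrix F₀ t).det) (a b : Fin n) :
    pd 0 (fun t => (corrMatrix F₀ t)⁻¹ a b) t = -((corrMatrix F₀ t)⁻¹ *
      (Matrix.of fun c d => multisetCorr F₀ {0, 0, c, d} t) * (corrMatrix F₀ t)⁻¹) a b := by
  have h : (Matrix.of fun c d => pd 0 (fun t => corrMatrix F₀ t c d) t) =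
      Matrix.of fun c d => multisetCorr F₀ {0, 0, c, d} t :=
    Matrix.ext fun c d => corr_eq_multisetCorr hU hF ht [0, 0, c, d]
  rw [pd_inv_apply (A := corrMatrix F₀) (fun c d => analyticOnNhd_corr hF [0, c, d] t ht) hM, h]

theorem analyticAt_contract {k m : ℕ} (hF : AnalyticOnNhd ℂ F₀ U) (ht : t ∈ U)
    (hM : IsUnit (corrMatrix F₀ t).det) (ends : Fin m → Fin k × Fin k) (legs : Fin k → ℕ) :
    AnalyticAt ℂ (fun t => contract ends legs (corrMatrix F₀ t)⁻¹
      fun m => multisetCorr F₀ m t) t :=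
  Finset.analyticAt_fun_sum _ fun _ _ =>
    (Finset.analyticAt_fun_prod _ fun _ _ => analyticAt_inv_corrMatrix hF ht hM _ _).fun_mul
      (Finset.analyticAt_fun_prod _ fun _ _ => analyticOnNhd_multisetCorr hF _ t ht)

/-- The derivative of a contraction along `∂/∂t^{1,0}`: a leg is added to each of the vertices,
and a vertex with two legs is inserted into each of the edges. -/
theorem pd_contract {k m : ℕ} (hU : IsOpen U) (hF : AnalyticOnNhd ℂ F₀ U) (ht : t ∈ U)
    (hM : IsUnit (corrMatrix F₀ t).det) (ends : Fin m → Fin k × Fin k) (legs : Fin k → ℕ) :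
    pd 0 (fun t => contract ends legs (corrMatrix F₀ t)⁻¹ fun m => multisetCorr F₀ m t) t =
      ∑ w, contract ends (Function.update legs w (legs w + 1)) (corrMatrix F₀ t)⁻¹
          (fun m => multisetCorr F₀ m t) -
        ∑ e, contract (subdivideEnds ends e) (subdivideLegs legs) (corrMatrix F₀ t)⁻¹
          (fun m => multisetCorr F₀ m t) := by
  have hI := fun a b => analyticAt_inv_corrMatrix hF ht hM a b
  have hC := fun m => analyticOnNhd_multisetCorr hF m t ht
  have hI' : ∀ c : Fin m → Fin n × Fin n,
      AnalyticAt ℂ (fun t => ∏ e, (corrMatrix F₀ t)⁻¹ (c e).1 (c e).2) t := fun c =>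
    Finset.analyticAt_fun_prod _ fun e _ => hI _ _
  have hC' : ∀ c : Fin m → Fin n × Fin n,
      AnalyticAt ℂ (fun t => ∏ w, multisetCorr F₀ (labels ends legs c w) t) t := fun c =>
    Finset.analyticAt_fun_prod _ fun w _ => hC _
  simp_rw [contract_addLeg, contract_subdivide]
  unfold contract
  rw [pd_sum _ fun c _ => (hI' c).fun_mul (hC' c), Finset.sum_comm,
    Finset.sum_comm (s := (Finset.univ : Finset (Fin m))), ← Finset.sum_sub_distrib]
  refine Finset.sum_congr rfl fun c _ => ?_
  rw [pd_mul (hI' c) (hC' c), pd_prod _ fun e _ => hI _ _, pd_prod _ fun w _ => hC _]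
  simp_rw [pd_inv_corrMatrix hU hF ht hM, pd_multisetCorr hU hF ht]
  rw [← Finset.mul_sum, ← Finset.sum_mul, sub_eq_add_neg, add_comm, ← neg_mul,
    ← Finset.sum_neg_distrib]
  simp only [mul_neg]

theorem analyticAt_value (hU : IsOpen U) (hF : AnalyticOnNhd ℂ F₀ U) (ht : t ∈ U)
    (hM : IsUnit (corrMatrix F₀ t).det) (Γ : DualGraph) : AnalyticAt ℂ (Γ.value F₀) t :=
  (analyticAt_contract hF ht hM Γ.ends Γ.legs).congr
    (Filter.eventuallyEq_of_mem (hU.mem_nhds ht) fun _ ht =>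
      (value_eq_contract hU hF ht Γ).symm)

theorem pd_value (hU : IsOpen U) (hF : AnalyticOnNhd ℂ F₀ U) (ht : t ∈ U)
    (hM : IsUnit (corrMatrix F₀ t).det) (Γ : DualGraph) :
    pd 0 (Γ.value F₀) t =
      ∑ w, contract Γ.ends (Function.update Γ.legs w (Γ.legs w + 1)) (corrMatrix F₀ t)⁻¹
          (fun m => multisetCorr F₀ m t) -
        ∑ e, contract (subdivideEnds Γ.ends e) (subdivideLegs Γ.legs) (corrMatrix F₀ t)⁻¹
          (fun m => multisetCorr F₀ m t) := by
  rw [pd_congr_of_eqOn hU (fun _ ht => value_eq_contract hU hF ht Γ) ht,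
    pd_contract hU hF ht hM]

end DualGraph

/-! ### The derivatives of the individual graphs. -/

namespace DualGraph

instance {k k' m m' : ℕ} (ends : Fin m → Fin k × Fin k) (legs : Fin k → ℕ)
    (ends' : Fin m' → Fin k' × Fin k') (legs' : Fin k' → ℕ) :
    Decidable (Iso ends legs ends' legs') := by
  unfold Iso
  infer_instance

variable {n : ℕ} [NeZero n] {F₀ : (Fin n → ℂ) → ℂ} {U : Set (Fin n → ℂ)} {t : Fin n → ℂ}

theorem contract_eq_value {k m : ℕ} (hU : IsOpen U) (hF : AnalyticOnNhd ℂ F₀ U) (ht : t ∈ U)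
    {ends : Fin m → Fin k × Fin k} {legs : Fin k → ℕ} {Γ : DualGraph}
    (h : Iso ends legs Γ.ends Γ.legs) :
    contract ends legs (corrMatrix F₀ t)⁻¹ (fun m => multisetCorr F₀ m t) = Γ.value F₀ t := by
  rw [value_eq_contract hU hF ht,
    contract_eq_of_iso h (corrMatrix_inv_isSymm hU hF ht)]

/-- Separates analysis from combinatorics: `A` and `B` name the graphs obtained from each vertex and
each edge, and the isomorphisms are left to a decision procedure. -/
theorem pd_value_of_iso (hU : IsOpen U) (hF : AnalyticOnNhd ℂ F₀ U) (ht : t ∈ U)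
    (hM : IsUnit (corrMatrix F₀ t).det) (Γ : DualGraph) (A : Fin Γ.numVertices → DualGraph)
    (B : Fin Γ.numEdges → DualGraph)
    (hA : ∀ w, Iso Γ.ends (Function.update Γ.legs w (Γ.legs w + 1)) (A w).ends (A w).legs)
    (hB : ∀ e, Iso (subdivideEnds Γ.ends e) (subdivideLegs Γ.legs) (B e).ends (B e).legs) :
    pd 0 (Γ.value F₀) t = ∑ w, (A w).value F₀ t - ∑ e, (B e).value F₀ t := by
  rw [pd_value hU hF ht hM]
  exact congrArg₂ _ (Finset.sum_congr rfl fun w _ => contract_eq_value hU hF ht (hA w))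
    (Finset.sum_congr rfl fun e _ => contract_eq_value hU hF ht (hB e))

theorem pd_value_graphP1 (hU : IsOpen U) (hF : AnalyticOnNhd ℂ F₀ U) (ht : t ∈ U)
    (hM : IsUnit (corrMatrix F₀ t).det) :
    pd 0 (graphP1.value F₀) t =
      graphQ1.value F₀ t - 2 * graphQ3.value F₀ t := by
  refine (pd_value_of_iso hU hF ht hM graphP1 ![graphQ1]
    ![graphQ3, graphQ3] (by decide +kernel) (by decide +kernel)).trans
    ((congrArg₂ _ (Fin.sum_univ_one _) (Fin.sum_univ_two _)).trans ?_)
  change graphQ1.value F₀ t -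
    (graphQ3.value F₀ t + graphQ3.value F₀ t) = _
  ring

theorem pd_value_graphP2 (hU : IsOpen U) (hF : AnalyticOnNhd ℂ F₀ U) (ht : t ∈ U)
    (hM : IsUnit (corrMatrix F₀ t).det) :
    pd 0 (graphP2.value F₀) t =
      graphQ3.value F₀ t + graphQ5.value F₀ t - graphQ7.value F₀ t - 2 * graphQ9.value F₀ t := by
  refine (pd_value_of_iso hU hF ht hM graphP2 ![graphQ3, graphQ5]
    ![graphQ7, graphQ9, graphQ9] (by decide +kernel) (by decide +kernel)).trans
    ((congrArg₂ _ (Fin.sum_univ_two _) (Fin.sum_univ_three _)).trans ?_)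
  change graphQ3.value F₀ t + graphQ5.value F₀ t -
    (graphQ7.value F₀ t + graphQ9.value F₀ t + graphQ9.value F₀ t) = _
  ring

theorem pd_value_graphP3 (hU : IsOpen U) (hF : AnalyticOnNhd ℂ F₀ U) (ht : t ∈ U)
    (hM : IsUnit (corrMatrix F₀ t).det) :
    pd 0 (graphP3.value F₀) t =
      graphQ4.value F₀ t + graphQ8.value F₀ t + graphQ10.value F₀ t
        - 2 * graphQ11.value F₀ t - 2 * graphQ12.value F₀ t := by
  -- The lists follow the numbering of `P₃`: a leg on `A`, `B`, `C` gives `Q₁₀`, `Q₄`, `Q₈`;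
  -- splitting one of the parallel edges `AB` gives `Q₁₁`, splitting `AC` or `BC` gives `Q₁₂`.
  refine (pd_value_of_iso hU hF ht hM graphP3 ![graphQ10, graphQ4, graphQ8]
    ![graphQ11, graphQ11, graphQ12, graphQ12] (by decide +kernel) (by decide +kernel)).trans
    ((congrArg₂ _ (Fin.sum_univ_three _) (Fin.sum_univ_four _)).trans ?_)
  change graphQ10.value F₀ t + graphQ4.value F₀ t + graphQ8.value F₀ t -
    (graphQ11.value F₀ t + graphQ11.value F₀ t + graphQ12.value F₀ t + graphQ12.value F₀ t) = _
  ring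

theorem pd_value_graphP4 (hU : IsOpen U) (hF : AnalyticOnNhd ℂ F₀ U) (ht : t ∈ U)
    (hM : IsUnit (corrMatrix F₀ t).det) :
    pd 0 (graphP4.value F₀) t =
      graphQ6.value F₀ t + graphQ2.value F₀ t - 3 * graphQ10.value F₀ t := by
  refine (pd_value_of_iso hU hF ht hM graphP4 ![graphQ6, graphQ2]
    ![graphQ10, graphQ10, graphQ10] (by decide +kernel) (by decide +kernel)).trans
    ((congrArg₂ _ (Fin.sum_univ_two _) (Fin.sum_univ_three _)).trans ?_)
  change graphQ6.value F₀ t + graphQ2.value F₀ t -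
    (graphQ10.value F₀ t + graphQ10.value F₀ t + graphQ10.value F₀ t) = _
  ring

theorem pd_value_graphP5 (hU : IsOpen U) (hF : AnalyticOnNhd ℂ F₀ U) (ht : t ∈ U)
    (hM : IsUnit (corrMatrix F₀ t).det) :
    pd 0 (graphP5.value F₀) t =
      2 * graphQ2.value F₀ t - 3 * graphQ4.value F₀ t := by
  refine (pd_value_of_iso hU hF ht hM graphP5 ![graphQ2, graphQ2]
    ![graphQ4, graphQ4, graphQ4] (by decide +kernel) (by decide +kernel)).trans
    ((congrArg₂ _ (Fin.sum_univ_two _) (Fin.sum_univ_three _)).trans ?_)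
  change graphQ2.value F₀ t + graphQ2.value F₀ t -
    (graphQ4.value F₀ t + graphQ4.value F₀ t + graphQ4.value F₀ t) = _
  ring

theorem pd_value_graphO1 (hU : IsOpen U) (hF : AnalyticOnNhd ℂ F₀ U) (ht : t ∈ U)
    (hM : IsUnit (corrMatrix F₀ t).det) :
    pd 0 (graphO1.value F₀) t =
      graphP1.value F₀ t - 2 * graphP2.value F₀ t := by
  refine (pd_value_of_iso hU hF ht hM graphO1 ![graphP1]
    ![graphP2, graphP2] (by decide +kernel) (by decide +kernel)).trans
    ((congrArg₂ _ (Fin.sum_univ_one _) (Fin.sum_univ_two _)).trans ?_)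
  change graphP1.value F₀ t -
    (graphP2.value F₀ t + graphP2.value F₀ t) = _
  ring

theorem pd_value_graphO2 (hU : IsOpen U) (hF : AnalyticOnNhd ℂ F₀ U) (ht : t ∈ U)
    (hM : IsUnit (corrMatrix F₀ t).det) :
    pd 0 (graphO2.value F₀) t =
      graphP4.value F₀ t + graphP5.value F₀ t - 3 * graphP3.value F₀ t := by
  refine (pd_value_of_iso hU hF ht hM graphO2 ![graphP4, graphP5]
    ![graphP3, graphP3, graphP3] (by decide +kernel) (by decide +kernel)).trans
    ((congrArg₂ _ (Fin.sum_univ_two _) (Fin.sum_univ_three _)).trans ?_)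
  change graphP4.value F₀ t + graphP5.value F₀ t -
    (graphP3.value F₀ t + graphP3.value F₀ t + graphP3.value F₀ t) = _
  ring

/-- The relation between the graphs is the second derivative of `O₁ - O₂`. -/
theorem graphRelation_eq (hU : IsOpen U) (hF : AnalyticOnNhd ℂ F₀ U)
    (hM : ∀ t ∈ U, IsUnit (corrMatrix F₀ t).det) (ht : t ∈ U) :
    graphRelation F₀ t =
      pd 0 (pd 0 fun τ => graphO1.value F₀ τ - graphO2.value F₀ τ) t := by
  have hA := fun Γ : DualGraph => analyticAt_value hU hF ht (hM t ht) Γ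
  have h : Set.EqOn (pd 0 fun τ => graphO1.value F₀ τ - graphO2.value F₀ τ)
      (fun τ => graphP1.value F₀ τ - 2 * graphP2.value F₀ τ -
        (graphP4.value F₀ τ + graphP5.value F₀ τ - 3 * graphP3.value F₀ τ)) U := fun τ hτ => by
    rw [pd_sub (analyticAt_value hU hF hτ (hM τ hτ) _) (analyticAt_value hU hF hτ (hM τ hτ) _),
      pd_value_graphO1 hU hF hτ (hM τ hτ), pd_value_graphO2 hU hF hτ (hM τ hτ)]
  have h2 := fun (c : ℂ) (Γ : DualGraph) => analyticAt_const (v := c).fun_mul (hA Γ)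
  rw [pd_congr_of_eqOn hU h ht,
    pd_sub ((hA _).fun_sub (h2 _ _)) (((hA _).fun_add (hA _)).fun_sub (h2 _ _)),
    pd_sub (hA _) (h2 _ _), pd_sub ((hA _).fun_add (hA _)) (h2 _ _), pd_add (hA _) (hA _),
    pd_const_mul _ (hA _), pd_const_mul _ (hA _), pd_value_graphP1 hU hF ht (hM t ht),
    pd_value_graphP2 hU hF ht (hM t ht), pd_value_graphP3 hU hF ht (hM t ht),
    pd_value_graphP4 hU hF ht (hM t ht), pd_value_graphP5 hU hF ht (hM t ht), graphRelation]
  ring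

end DualGraph

/-! ### The canonical frame and the Egorov property of the metric. -/

open Matrix in
theorem pd_dotProduct_mulVec {n : ℕ} {u : Fin n → ℂ} {f g : (Fin n → ℂ) → Fin n → ℂ}
    (hf : ∀ α, AnalyticAt ℂ (fun u => f u α) u)
    (hg : ∀ α, AnalyticAt ℂ (fun u => g u α) u) (A : Matrix (Fin n) (Fin n) ℂ) (l : Fin n) :
    pd l (fun u => f u ⬝ᵥ A *ᵥ g u) u =
      (fun α => pd l (fun u => f u α) u) ⬝ᵥ A *ᵥ g u +
        f u ⬝ᵥ A *ᵥ fun α => pd l (fun u => g u α) u := by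
  have hg' : ∀ α, AnalyticAt ℂ (fun u => ∑ β, A α β * g u β) u := fun α =>
    Finset.analyticAt_fun_sum _ fun β _ => analyticAt_const.fun_mul (hg β)
  simp only [dotProduct, mulVec]
  rw [pd_sum _ fun α _ => (hf α).fun_mul (hg' α), ← Finset.sum_add_distrib]
  refine Finset.sum_congr rfl fun α _ => ?_
  rw [pd_mul (hf α) (hg' α), pd_sum _ fun β _ => analyticAt_const.fun_mul (hg β)]
  simp_rw [pd_const_mul _ (hg _)]

namespace FrobeniusManifold

open Matrix

variable {n : ℕ} [NeZero n]

/-- The symmetric trilinear form `⟨x · y, z⟩` on the tangent space at `v`. -/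
noncomputable def trilinear (X : FrobeniusManifold n) (v x y z : Fin n → ℂ) : ℂ :=
  ∑ α, x α * (y ⬝ᵥ X.cubic α v *ᵥ z)

theorem trilinear_swap_right (X : FrobeniusManifold n) {v : Fin n → ℂ} (hv : v ∈ X.domain)
    (x y z : Fin n → ℂ) : X.trilinear v x y z = X.trilinear v x z y :=
  Finset.sum_congr rfl fun α _ => by
    rw [dotProduct_mulVec_comm_of_isSymm (X.cubic_isSymm hv α)]

theorem trilinear_swap_left (X : FrobeniusManifold n) {v : Fin n → ℂ} (hv : v ∈ X.domain)
    (x y z : Fin n → ℂ) : X.trilinear v x y z = X.trilinear v y x z := by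
  simp only [trilinear, dotProduct, mulVec, Finset.mul_sum]
  rw [Finset.sum_comm]
  refine Finset.sum_congr rfl fun α _ => Finset.sum_congr rfl fun β _ =>
    Finset.sum_congr rfl fun γ _ => ?_
  rw [X.cubic_swap hv β α γ]
  ring

theorem trilinear_unit (X : FrobeniusManifold n) {v : Fin n → ℂ} (hv : v ∈ X.domain)
    (y z : Fin n → ℂ) : X.trilinear v (Pi.single 0 1) y z = y ⬝ᵥ X.eta *ᵥ z := by
  rw [trilinear, Finset.sum_eq_single 0 (fun α _ hα => by simp [hα]) (by simp), X.cubic_zero hv]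
  simp

theorem trilinear_smul_left (X : FrobeniusManifold n) (v : Fin n → ℂ) (c : ℂ)
    (x y z : Fin n → ℂ) : X.trilinear v (c • x) y z = c * X.trilinear v x y z := by
  simp only [trilinear, Finset.mul_sum, Pi.smul_apply, smul_eq_mul, mul_assoc]

namespace CanonicalCoordinates

variable {X : FrobeniusManifold n} (K : X.CanonicalCoordinates) {u : Fin n → ℂ}

/-- The components of the vector field `∂/∂u_i` in the flat coordinates. -/
noncomputable def frame (i : Fin n) (u : Fin n → ℂ) : Fin n → ℂ :=
  fun α => pd i (fun w => K.chart.symm w α) u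

/-- The derivative `∂/∂u_l` of the components of the vector field `∂/∂u_i`. -/
noncomputable def frameDeriv (l i : Fin n) (u : Fin n → ℂ) : Fin n → ℂ :=
  fun α => pd l (fun w => K.frame i w α) u

theorem symm_mem (hu : u ∈ K.chart.target) : K.chart.symm u ∈ X.domain :=
  K.source_subset (K.chart.map_target hu)

theorem analyticAt_frame (hu : u ∈ K.chart.target) (i α : Fin n) :
    AnalyticAt ℂ (fun u => K.frame i u α) u :=
  ((K.analytic_symm u hu).coord α).pd i

theorem frameDeriv_comm (hu : u ∈ K.chart.target) (l i : Fin n) :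
    K.frameDeriv l i u = K.frameDeriv i l u :=
  funext fun α => pd_comm ((K.analytic_symm u hu).coord α)

/-- This is `∂_i · ∂_j = δ_ij ∂_i` paired with `z` by the metric. -/
theorem trilinear_frame (hu : u ∈ K.chart.target) (i j : Fin n) (z : Fin n → ℂ) :
    X.trilinear (K.chart.symm u) (K.frame i u) (K.frame j u) z =
      if i = j then K.frame i u ⬝ᵥ X.eta *ᵥ z else 0 := by
  have h : ∑ α, K.frame i u α • ((X.eta⁻¹ * X.cubic α (K.chart.symm u)) *ᵥ K.frame j u) =
      if i = j then K.frame i u else 0 := by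
    funext γ
    have h0 := K.mul_frame u hu i j γ
    simp_rw [X.structConst_eq (K.symm_mem hu)] at h0
    rw [Finset.sum_apply]
    refine Eq.trans ?_ (h0.trans ?_)
    · refine Finset.sum_congr rfl fun α _ => ?_
      rw [Pi.smul_apply, smul_eq_mul, mulVec, dotProduct, Finset.mul_sum]
      exact Finset.sum_congr rfl fun β _ => by simp only [frame]; ring
    · split_ifs <;> rfl
  have h' := congrArg (fun x => z ⬝ᵥ X.eta *ᵥ x) h
  simp only [mulVec_sum, dotProduct_sum, mulVec_smul, dotProduct_smul, mulVec_mulVec,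
    ← Matrix.mul_assoc, X.eta_mul_inv, one_mul, smul_eq_mul] at h'
  rw [X.trilinear_swap_right (K.symm_mem hu), trilinear, h']
  split_ifs
  · exact dotProduct_mulVec_comm_of_isSymm X.eta_symm _ _
  · simp

theorem metricCoeff_eq (i : Fin n) (u : Fin n → ℂ) :
    K.metricCoeff i u = K.frame i u ⬝ᵥ X.eta *ᵥ K.frame i u := by
  simp only [metricCoeff, dotProduct, mulVec, Finset.mul_sum, frame]
  exact Finset.sum_congr rfl fun _ _ => Finset.sum_congr rfl fun _ _ => by ring

/-- Invariance of the metric gives `⟨∂_i, ∂_j⟩ = ⟨∂_i · ∂_j, e⟩`. -/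
theorem frame_pair (hu : u ∈ K.chart.target) (i j : Fin n) :
    K.frame i u ⬝ᵥ X.eta *ᵥ K.frame j u =
      if i = j then K.frame i u ⬝ᵥ X.eta *ᵥ Pi.single 0 1 else 0 := by
  rw [← K.trilinear_frame hu, X.trilinear_swap_right (K.symm_mem hu),
    X.trilinear_swap_left (K.symm_mem hu), X.trilinear_unit (K.symm_mem hu)]

theorem frame_pair_of_ne (hu : u ∈ K.chart.target) {i j : Fin n} (h : i ≠ j) :
    K.frame i u ⬝ᵥ X.eta *ᵥ K.frame j u = 0 := by
  rw [K.frame_pair hu, if_neg h]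

theorem metricCoeff_eq_unit (hu : u ∈ K.chart.target) (i : Fin n) :
    K.metricCoeff i u = K.frame i u ⬝ᵥ X.eta *ᵥ Pi.single 0 1 := by
  rw [metricCoeff_eq, K.frame_pair hu, if_pos rfl]

theorem frame_pair_eq (hu : u ∈ K.chart.target) (i j : Fin n) :
    K.frame i u ⬝ᵥ X.eta *ᵥ K.frame j u = if i = j then K.metricCoeff i u else 0 := by
  rw [K.frame_pair hu, K.metricCoeff_eq_unit hu]

theorem pd_metricCoeff (hu : u ∈ K.chart.target) (l i : Fin n) :
    pd l (K.metricCoeff i) u = 2 * (K.frame i u ⬝ᵥ X.eta *ᵥ K.frameDeriv l i u) := by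
  rw [pd_congr_of_eventuallyEq (Filter.Eventually.of_forall fun u => K.metricCoeff_eq i u),
    pd_dotProduct_mulVec (fun α => K.analyticAt_frame hu i α) (fun α => K.analyticAt_frame hu i α),
    dotProduct_mulVec_comm_of_isSymm X.eta_symm, two_mul]
  rfl

/-- The metric is Egorov: `∂_l η_{ii} = ∂_i η_{ll}`. -/
theorem pd_metricCoeff_comm (hu : u ∈ K.chart.target) (l i : Fin n) :
    pd l (K.metricCoeff i) u = pd i (K.metricCoeff l) u := by
  -- As `η_ii = ⟨∂_i, e⟩` and `e` is constant in flat coordinates, `∂_l η_ii` is the pairing of `e`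
  -- with a mixed second derivative, symmetric in `l` and `i`.
  have h : ∀ l i, pd l (K.metricCoeff i) u =
      K.frameDeriv l i u ⬝ᵥ X.eta *ᵥ Pi.single 0 1 := fun l i => by
    rw [pd_congr_of_eqOn K.chart.open_target (fun u hu => K.metricCoeff_eq_unit hu i) hu,
      pd_dotProduct_mulVec (g := fun _ => Pi.single 0 1) (fun α => K.analyticAt_frame hu i α)
        (fun _ => analyticAt_const)]
    simp only [pd_const]
    rw [show (fun _ : Fin n => (0 : ℂ)) = 0 from rfl, mulVec_zero, dotProduct_zero, add_zero]
    rfl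
  rw [h, h, K.frameDeriv_comm hu]

theorem frame_pair_frameDeriv_left (hu : u ∈ K.chart.target) (i j : Fin n) :
    K.frame i u ⬝ᵥ X.eta *ᵥ K.frameDeriv i j u = pd j (K.metricCoeff i) u / 2 := by
  rw [K.frameDeriv_comm hu, K.pd_metricCoeff hu]
  ring

/-- Differentiate `⟨∂_i, ∂_j⟩ = 0` along `u_j`. -/
theorem frame_pair_frameDeriv_right (hu : u ∈ K.chart.target) {i j : Fin n} (h : i ≠ j) :
    K.frame i u ⬝ᵥ X.eta *ᵥ K.frameDeriv j j u = -(pd i (K.metricCoeff j) u / 2) := by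
  have h0 : pd j (fun u => K.frame i u ⬝ᵥ X.eta *ᵥ K.frame j u) u = 0 := by
    rw [pd_congr_of_eqOn (g := fun _ => 0) K.chart.open_target
      (fun u hu => K.frame_pair_of_ne hu h) hu, pd_const]
  rw [pd_dotProduct_mulVec (fun α => K.analyticAt_frame hu i α)
    (fun α => K.analyticAt_frame hu j α)] at h0
  rw [← K.frame_pair_frameDeriv_left hu, dotProduct_mulVec_comm_of_isSymm X.eta_symm (K.frame j u)]
  exact eq_neg_of_add_eq_zero_right h0

/-- The matrix whose columns are the coordinate vector fields `∂/∂u_i`. -/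
noncomputable def frameMatrix (u : Fin n → ℂ) : Matrix (Fin n) (Fin n) ℂ :=
  Matrix.of fun α i => K.frame i u α

/-- The matrix of the partial derivatives `∂u_k/∂v^α`. -/
noncomputable def coframeMatrix (u : Fin n → ℂ) : Matrix (Fin n) (Fin n) ℂ :=
  Matrix.of fun k α => pd α (fun y => K.chart y k) (K.chart.symm u)

theorem coframeMatrix_mul (hu : u ∈ K.chart.target) :
    K.coframeMatrix u * K.frameMatrix u = 1 := by
  ext k i
  have h : pd i (fun w => K.chart (K.chart.symm w) k) u = if i = k then 1 else 0 := by
    rw [← pd_coord k]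
    exact pd_congr_of_eqOn K.chart.open_target
      (fun w hw => by simp only [K.chart.right_inv hw]) hu
  rw [pd_comp (f := fun y => K.chart y k)
    ((K.analytic _ (K.chart.map_target hu)).coord k) (K.analytic_symm u hu)] at h
  rw [mul_apply, Matrix.one_apply]
  simp_rw [eq_comm (a := k)]
  exact h

theorem frameMatrix_mul (hu : u ∈ K.chart.target) :
    K.frameMatrix u * K.coframeMatrix u = 1 := mul_eq_one_comm.1 (K.coframeMatrix_mul hu)

theorem frameMatrix_mulVec (u c : Fin n → ℂ) :
    K.frameMatrix u *ᵥ c = ∑ j, c j • K.frame j u := by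
  funext α
  simp [mulVec, dotProduct, frameMatrix, mul_comm]

/-- A Gram matrix in the frame `∂/∂u_i`. -/
theorem transpose_mul_frameMatrix_apply (A : Matrix (Fin n) (Fin n) ℂ) (i j : Fin n) :
    ((K.frameMatrix u)ᵀ * A * K.frameMatrix u) i j = K.frame i u ⬝ᵥ A *ᵥ K.frame j u := by
  rw [Matrix.mul_assoc]
  rfl

/-- The `η_ii` are the diagonal of the Gram matrix of a nondegenerate form in an orthogonal basis.
-/
theorem metricCoeff_ne_zero (hu : u ∈ K.chart.target) (i : Fin n) : K.metricCoeff i u ≠ 0 := by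
  have h : (K.frameMatrix u)ᵀ * X.eta * K.frameMatrix u =
      diagonal fun i => K.metricCoeff i u := by
    ext i j
    rw [transpose_mul_frameMatrix_apply, K.frame_pair_eq hu, diagonal_apply]
  have hd : IsUnit ((K.frameMatrix u)ᵀ * X.eta * K.frameMatrix u).det := by
    have hE : IsUnit (K.frameMatrix u).det := isUnit_det_of_right_inverse (K.frameMatrix_mul hu)
    rw [det_mul, det_mul, det_transpose]
    exact (hE.mul X.eta_nondeg).mul hE
  rw [h, det_diagonal] at hd
  exact Finset.prod_ne_zero_iff.1 hd.ne_zero i (Finset.mem_univ i)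

/-- Every vector `x` is the combination `∑ (⟨∂_j, x⟩ / η_{jj}) ∂_j`. -/
theorem eq_sum_frame (hu : u ∈ K.chart.target) (x : Fin n → ℂ) :
    x = ∑ j, ((K.frame j u ⬝ᵥ X.eta *ᵥ x) / K.metricCoeff j u) • K.frame j u := by
  have hx : x = ∑ j, (K.coframeMatrix u *ᵥ x) j • K.frame j u := by
    rw [← frameMatrix_mulVec, mulVec_mulVec, K.frameMatrix_mul hu, one_mulVec]
  have hc : ∀ j, K.frame j u ⬝ᵥ X.eta *ᵥ x =
      (K.coframeMatrix u *ᵥ x) j * K.metricCoeff j u := fun j => by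
    conv_lhs => rw [hx]
    simp only [mulVec_sum, dotProduct_sum, mulVec_smul, dotProduct_smul, K.frame_pair_eq hu,
      smul_eq_mul]
    simp
  conv_lhs => rw [hx]
  exact Finset.sum_congr rfl fun j _ => by
    rw [hc, mul_div_cancel_right₀ _ (K.metricCoeff_ne_zero hu j)]

/-- All coefficients are `⟨∂_j, e⟩ / η_jj = 1`. -/
theorem unit_eq_sum_frame (hu : u ∈ K.chart.target) :
    (Pi.single 0 1 : Fin n → ℂ) = ∑ j, K.frame j u := by
  conv_lhs => rw [K.eq_sum_frame hu (Pi.single 0 1)]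
  refine Finset.sum_congr rfl fun j _ => ?_
  rw [← K.metricCoeff_eq_unit hu, div_self (K.metricCoeff_ne_zero hu j), one_smul]

end CanonicalCoordinates

end FrobeniusManifold

/-! ### Correlators as multilinear forms. -/

section CorrelatorForms

variable {n : ℕ} (F₀ : (Fin n → ℂ) → ℂ) (t : Fin n → ℂ)

/-- The trilinear form with the components `∂³𝓕₀ / ∂t^{α,0} ∂t^{β,0} ∂t^{γ,0}`. -/
noncomputable def corrForm₃ (x y z : Fin n → ℂ) : ℂ :=
  ∑ a, ∑ b, ∑ c, corr F₀ [a, b, c] t * (x a * y b * z c)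

/-- The quadrilinear form with the fourth derivatives of `𝓕₀` as components. -/
noncomputable def corrForm₄ (x y z w : Fin n → ℂ) : ℂ :=
  ∑ a, ∑ b, ∑ c, ∑ d, corr F₀ [a, b, c, d] t * (x a * y b * z c * w d)

variable {F₀ t} {U : Set (Fin n → ℂ)}

theorem corrForm₄_swap₁₂ (hU : IsOpen U) (hF : AnalyticOnNhd ℂ F₀ U) (ht : t ∈ U)
    (x y z w : Fin n → ℂ) : corrForm₄ F₀ t x y z w = corrForm₄ F₀ t y x z w := by
  unfold corrForm₄
  rw [Finset.sum_comm]
  refine Finset.sum_congr rfl fun a _ => Finset.sum_congr rfl fun b _ =>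
    Finset.sum_congr rfl fun c _ => Finset.sum_congr rfl fun d _ => ?_
  rw [corr_perm hU hF (List.Perm.swap a b [c, d]) ht]
  ring

theorem corrForm₄_swap₂₃ (hU : IsOpen U) (hF : AnalyticOnNhd ℂ F₀ U) (ht : t ∈ U)
    (x y z w : Fin n → ℂ) : corrForm₄ F₀ t x y z w = corrForm₄ F₀ t x z y w := by
  unfold corrForm₄
  refine Finset.sum_congr rfl fun a _ => ?_
  rw [Finset.sum_comm]
  refine Finset.sum_congr rfl fun b _ =>
    Finset.sum_congr rfl fun c _ => Finset.sum_congr rfl fun d _ => ?_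
  rw [corr_perm hU hF ((List.Perm.swap b c [d]).cons a) ht]
  ring

theorem corrForm₄_swap₃₄ (hU : IsOpen U) (hF : AnalyticOnNhd ℂ F₀ U) (ht : t ∈ U)
    (x y z w : Fin n → ℂ) : corrForm₄ F₀ t x y z w = corrForm₄ F₀ t x y w z := by
  unfold corrForm₄
  refine Finset.sum_congr rfl fun a _ => Finset.sum_congr rfl fun b _ => ?_
  rw [Finset.sum_comm]
  refine Finset.sum_congr rfl fun c _ => Finset.sum_congr rfl fun d _ => ?_
  rw [corr_perm hU hF (((List.Perm.swap c d []).cons b).cons a) ht]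
  ring

theorem corrForm₄_sum_left {ι : Type*} (s : Finset ι) (f : ι → Fin n → ℂ) (y z w : Fin n → ℂ) :
    corrForm₄ F₀ t (∑ j ∈ s, f j) y z w = ∑ j ∈ s, corrForm₄ F₀ t (f j) y z w := by
  simp only [corrForm₄, Finset.sum_apply, Finset.sum_mul, Finset.mul_sum]
  refine Eq.trans ?_ Finset.sum_comm
  refine Finset.sum_congr rfl fun a _ => Eq.trans ?_ Finset.sum_comm
  refine Finset.sum_congr rfl fun b _ => Eq.trans ?_ Finset.sum_comm
  exact Finset.sum_congr rfl fun c _ => Finset.sum_comm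

theorem corrForm₄_single_left (α : Fin n) (x y z : Fin n → ℂ) :
    corrForm₄ F₀ t (Pi.single α 1) x y z =
      ∑ b, ∑ c, ∑ d, corr F₀ [α, b, c, d] t * (x b * y c * z d) := by
  rw [corrForm₄, Finset.sum_eq_single α (fun a _ ha => by simp [ha]) (by simp)]
  simp only [Pi.single_eq_same, one_mul]

end CorrelatorForms

/-! ### The three- and four-point tensors in the canonical frame. -/

namespace FrobeniusManifold

open Matrix

variable {n : ℕ} [NeZero n] {X : FrobeniusManifold n} {Θ : X.Calibration} {N : ℕ}
  {s : ℕ → Fin n → ℂ} {U : Set (Fin n → ℂ)} {v : (Fin n → ℂ) → (Fin n → ℂ)} {t : Fin n → ℂ}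

namespace IsTopologicalSolution

theorem corrForm₃_eq (hv : X.IsTopologicalSolution Θ N s U v) (ht : t ∈ U) (z x y : Fin n → ℂ) :
    corrForm₃ (Θ.freeEnergy N s v) t z x y = X.trilinear (v t) (z ᵥ* jacobian v t) x y := by
  simp only [corrForm₃, trilinear, hv.corr_three ht, vecMul, dotProduct, mulVec,
    Finset.sum_mul_sum]
  refine Eq.trans (Finset.sum_congr rfl fun δ _ => ?_) Finset.sum_comm
  refine Eq.trans (Finset.sum_congr rfl fun γ _ => ?_) Finset.sum_comm
  simp only [Finset.sum_mul, Finset.mul_sum]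
  rw [Finset.sum_comm]
  refine Finset.sum_congr rfl fun ξ _ => Finset.sum_congr rfl fun α _ => ?_
  simp only [jacobian, Matrix.of_apply]
  ring

theorem corrMatrix_apply (hv : X.IsTopologicalSolution Θ N s U v) (ht : t ∈ U)
    (x y : Fin n → ℂ) :
    x ⬝ᵥ corrMatrix (Θ.freeEnergy N s v) t *ᵥ y =
      X.trilinear (v t) (fun ξ => pd 0 (fun t => v t ξ) t) x y := by
  have h : ∀ a b, corrMatrix (Θ.freeEnergy N s v) t a b =
      ∑ ξ, X.cubic ξ (v t) a b * pd 0 (fun t => v t ξ) t := hv.corr_three ht 0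
  simp only [trilinear, dotProduct, mulVec, h, Finset.sum_mul, Finset.mul_sum]
  refine Eq.trans ?_ Finset.sum_comm
  refine Finset.sum_congr rfl fun a _ => Eq.trans ?_ Finset.sum_comm
  refine Finset.sum_congr rfl fun b _ => Finset.sum_congr rfl fun ξ _ => ?_
  ring

variable (K : X.CanonicalCoordinates)

/-- The coefficients `⟨∂_i, ∂v/∂t^{1,0}⟩` of the matrix `M` in the frame `∂/∂u_i`. -/
noncomputable def _root_.FrobeniusManifold.CanonicalCoordinates.velocityPair
    (v : (Fin n → ℂ) → (Fin n → ℂ)) (t : Fin n → ℂ) (i : Fin n) : ℂ :=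
  K.frame i (K.chart (v t)) ⬝ᵥ X.eta *ᵥ fun ξ => pd 0 (fun t => v t ξ) t

variable {K}

/-- `M` is the form `⟨∂_x v · x, y⟩`, so a frame of orthogonal idempotents diagonalises it. -/
theorem frame_corrMatrix_frame (hv : X.IsTopologicalSolution Θ N s U v) (ht : t ∈ U)
    (hs : v t ∈ K.chart.source) (i j : Fin n) :
    K.frame i (K.chart (v t)) ⬝ᵥ corrMatrix (Θ.freeEnergy N s v) t *ᵥ
      K.frame j (K.chart (v t)) = if i = j then K.velocityPair v t i else 0 := by
  have h := K.trilinear_frame (K.chart.map_source hs) i j fun ξ => pd 0 (fun t => v t ξ) t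
  rw [K.chart.left_inv hs] at h
  rw [hv.corrMatrix_apply ht, X.trilinear_swap_left (hv.mapsTo ht),
    X.trilinear_swap_right (hv.mapsTo ht), h]
  rfl

theorem transpose_mul_corrMatrix_mul (hv : X.IsTopologicalSolution Θ N s U v) (ht : t ∈ U)
    (hs : v t ∈ K.chart.source) :
    (K.frameMatrix (K.chart (v t)))ᵀ * corrMatrix (Θ.freeEnergy N s v) t *
      K.frameMatrix (K.chart (v t)) = diagonal (K.velocityPair v t) := by
  ext i j
  rw [K.transpose_mul_frameMatrix_apply, hv.frame_corrMatrix_frame ht hs, diagonal_apply]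

theorem velocityPair_ne_zero (hv : X.IsTopologicalSolution Θ N s U v) (ht : t ∈ U)
    (hs : v t ∈ K.chart.source) (i : Fin n) : K.velocityPair v t i ≠ 0 := by
  have hE : IsUnit (K.frameMatrix (K.chart (v t))).det :=
    isUnit_det_of_right_inverse (K.frameMatrix_mul (K.chart.map_source hs))
  have hd := (hE.mul (hv.isUnit_det_corrMatrix ht)).mul hE
  rw [← det_transpose (K.frameMatrix _), ← det_mul] at hd
  rw [det_transpose, ← det_mul, hv.transpose_mul_corrMatrix_mul ht hs, det_diagonal] at hd
  exact Finset.prod_ne_zero_iff.1 hd.ne_zero i (Finset.mem_univ i)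

/-- If `E` is the frame matrix and `Eᵀ M E = D` is diagonal, then `M⁻¹ = E D⁻¹ Eᵀ`. -/
theorem inv_corrMatrix_apply (hv : X.IsTopologicalSolution Θ N s U v) (ht : t ∈ U)
    (hs : v t ∈ K.chart.source) (a b : Fin n) :
    (corrMatrix (Θ.freeEnergy N s v) t)⁻¹ a b =
      ∑ i, K.frame i (K.chart (v t)) a * K.frame i (K.chart (v t)) b / K.velocityPair v t i := by
  have hm := hv.velocityPair_ne_zero ht hs
  have hEA := K.frameMatrix_mul (K.chart.map_source hs)
  have hinv : (corrMatrix (Θ.freeEnergy N s v) t)⁻¹ = K.frameMatrix (K.chart (v t)) *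
      diagonal (fun i => (K.velocityPair v t i)⁻¹) * (K.frameMatrix (K.chart (v t)))ᵀ := by
    refine inv_eq_right_inv ?_
    have hD : diagonal (K.velocityPair v t) * diagonal (fun i => (K.velocityPair v t i)⁻¹) = 1 := by
      rw [diagonal_mul_diagonal, ← diagonal_one]
      exact congrArg diagonal (funext fun i => mul_inv_cancel₀ (hm i))
    have hAt := congrArg Matrix.transpose hEA
    rw [transpose_mul, transpose_one] at hAt
    rw [← hv.transpose_mul_corrMatrix_mul ht hs] at hD
    generalize diagonal (fun i => (K.velocityPair v t i)⁻¹) = D at *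
    calc corrMatrix (Θ.freeEnergy N s v) t * (K.frameMatrix (K.chart (v t)) * D *
          (K.frameMatrix (K.chart (v t)))ᵀ)
        = ((K.coframeMatrix (K.chart (v t)))ᵀ * (K.frameMatrix (K.chart (v t)))ᵀ) *
          (corrMatrix (Θ.freeEnergy N s v) t * (K.frameMatrix (K.chart (v t)) * D *
          (K.frameMatrix (K.chart (v t)))ᵀ)) := by rw [hAt, one_mul]
      _ = (K.coframeMatrix (K.chart (v t)))ᵀ * ((K.frameMatrix (K.chart (v t)))ᵀ *
          corrMatrix (Θ.freeEnergy N s v) t * K.frameMatrix (K.chart (v t)) * D) *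
          (K.frameMatrix (K.chart (v t)))ᵀ := by simp only [Matrix.mul_assoc]
      _ = 1 := by rw [hD, mul_one, hAt]
  rw [hinv, mul_apply]
  refine Finset.sum_congr rfl fun i _ => ?_
  rw [mul_diagonal, transpose_apply, div_eq_mul_inv]
  simp only [CanonicalCoordinates.frameMatrix, Matrix.of_apply]
  ring

/-- `v` flows along the canonical vector fields with velocities `u_{i,x}`. -/
theorem frame_vecMul_jacobian (hv : X.IsTopologicalSolution Θ N s U v) (ht : t ∈ U)
    (hs : v t ∈ K.chart.source) (l : Fin n) :
    K.frame l (K.chart (v t)) ᵥ* jacobian v t =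
      (K.velocityPair v t l / K.metricCoeff l (K.chart (v t))) • K.frame l (K.chart (v t)) := by
  -- Because `M = J η`, pairing the pushed vector with `f_j` gives an entry of the diagonal matrix
  -- of `M`.
  have h : ∀ j, K.frame j (K.chart (v t)) ⬝ᵥ X.eta *ᵥ
      (K.frame l (K.chart (v t)) ᵥ* jacobian v t) =
        if l = j then K.velocityPair v t l else 0 := fun j => by
    rw [dotProduct_mulVec_comm_of_isSymm X.eta_symm, ← hv.frame_corrMatrix_frame ht hs,
      hv.corrMatrix_eq ht, ← dotProduct_mulVec, mulVec_mulVec]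
  rw [K.eq_sum_frame (K.chart.map_source hs) (_ ᵥ* _)]
  simp_rw [h]
  rw [Finset.sum_eq_single l (fun j _ hj => by simp [hj.symm]) (by simp), if_pos rfl]

/-- The Jacobian only rescales `f_k`, which leaves `⟨f_k · f_j, x⟩`. The last argument stays
arbitrary so that derivatives of the frame can be inserted. -/
theorem corrForm₃_frame (hv : X.IsTopologicalSolution Θ N s U v) (ht : t ∈ U)
    (hs : v t ∈ K.chart.source) (k j : Fin n) (x : Fin n → ℂ) :
    corrForm₃ (Θ.freeEnergy N s v) t (K.frame k (K.chart (v t))) (K.frame j (K.chart (v t))) x =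
      if k = j then K.velocityPair v t k / K.metricCoeff k (K.chart (v t)) *
        (K.frame k (K.chart (v t)) ⬝ᵥ X.eta *ᵥ x) else 0 := by
  have h := K.trilinear_frame (K.chart.map_source hs) k j x
  rw [K.chart.left_inv hs] at h
  rw [hv.corrForm₃_eq ht, hv.frame_vecMul_jacobian ht hs, trilinear_smul_left, h]
  split_ifs <;> simp

theorem corrForm₃_swap (hv : X.IsTopologicalSolution Θ N s U v) (ht : t ∈ U)
    (x y z : Fin n → ℂ) : corrForm₃ (Θ.freeEnergy N s v) t x y z =
      corrForm₃ (Θ.freeEnergy N s v) t x z y := by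
  rw [hv.corrForm₃_eq ht, hv.corrForm₃_eq ht, X.trilinear_swap_right (hv.mapsTo ht)]

theorem analyticAt_chart_comp (hv : X.IsTopologicalSolution Θ N s U v) (ht : t ∈ U)
    (hs : v t ∈ K.chart.source) : AnalyticAt ℂ (fun t => K.chart (v t)) t :=
  (K.analytic (v t) hs).comp (hv.analytic t ht)

theorem analyticAt_frame_comp (hv : X.IsTopologicalSolution Θ N s U v) (ht : t ∈ U)
    (hs : v t ∈ K.chart.source) (i α : Fin n) :
    AnalyticAt ℂ (fun t => K.frame i (K.chart (v t)) α) t :=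
  AnalyticAt.comp (g := fun u => K.frame i u α) (f := fun t => K.chart (v t))
    (K.analyticAt_frame (K.chart.map_source hs) i α) (hv.analyticAt_chart_comp ht hs)

theorem sum_frame_mul_pd_chart (hv : X.IsTopologicalSolution Θ N s U v) (ht : t ∈ U)
    (hs : v t ∈ K.chart.source) (l k : Fin n) :
    ∑ β, K.frame l (K.chart (v t)) β * pd β (fun t => K.chart (v t) k) t =
      if k = l then K.velocityPair v t l / K.metricCoeff l (K.chart (v t)) else 0 := by
  have h : ∀ β, pd β (fun t => K.chart (v t) k) t =
      ∑ ξ, K.coframeMatrix (K.chart (v t)) k ξ * jacobian v t β ξ := fun β => by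
    rw [pd_comp (f := fun y => K.chart y k) ((K.analytic (v t) hs).coord k) (hv.analytic t ht)]
    simp only [CanonicalCoordinates.coframeMatrix, K.chart.left_inv hs, Matrix.of_apply, jacobian]
  have h1 := congrFun (congrArg (fun x => K.coframeMatrix (K.chart (v t)) *ᵥ x)
    (hv.frame_vecMul_jacobian ht hs l)) k
  have h2 := congrFun (congrFun (K.coframeMatrix_mul (K.chart.map_source hs)) k) l
  have h3 : (K.coframeMatrix (K.chart (v t)) *ᵥ K.frame l (K.chart (v t))) k =
      if k = l then 1 else 0 := h2.trans (Matrix.one_apply)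
  rw [mulVec_smul, Pi.smul_apply, h3, smul_eq_mul, mul_ite, mul_one, mul_zero] at h1
  rw [← h1]
  simp only [h, mulVec, vecMul, dotProduct, Finset.mul_sum]
  rw [Finset.sum_comm]
  exact Finset.sum_congr rfl fun _ _ => Finset.sum_congr rfl fun _ _ => by ring

/-- The derivative of the frame along itself. -/
theorem sum_frame_mul_pd_frame (hv : X.IsTopologicalSolution Θ N s U v) (ht : t ∈ U)
    (hs : v t ∈ K.chart.source) (l i γ : Fin n) :
    ∑ β, K.frame l (K.chart (v t)) β * pd β (fun t => K.frame i (K.chart (v t)) γ) t =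
      K.velocityPair v t l / K.metricCoeff l (K.chart (v t)) *
        K.frameDeriv l i (K.chart (v t)) γ := by
  have h : ∀ β, pd β (fun t => K.frame i (K.chart (v t)) γ) t =
      ∑ k, pd k (fun u => K.frame i u γ) (K.chart (v t)) *
        pd β (fun t => K.chart (v t) k) t := fun β =>
    pd_comp (f := fun u => K.frame i u γ) (K.analyticAt_frame (K.chart.map_source hs) i γ)
      (hv.analyticAt_chart_comp ht hs)
  simp_rw [h, Finset.mul_sum]
  rw [Finset.sum_comm]
  have h' : ∀ k, ∑ β, K.frame l (K.chart (v t)) β *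
      (pd k (fun u => K.frame i u γ) (K.chart (v t)) * pd β (fun t => K.chart (v t) k) t) =
      pd k (fun u => K.frame i u γ) (K.chart (v t)) *
        if k = l then K.velocityPair v t l / K.metricCoeff l (K.chart (v t)) else 0 := fun k => by
    rw [← hv.sum_frame_mul_pd_chart ht hs, Finset.mul_sum]
    exact Finset.sum_congr rfl fun _ _ => by ring
  simp_rw [h']
  rw [Finset.sum_eq_single l (fun k _ hk => by simp [hk]) (by simp), if_pos rfl, mul_comm]
  rfl

/-- The fourth derivatives of the free energy in the frame `∂/∂u_i`. -/
theorem corrForm₄_frame (hv : X.IsTopologicalSolution Θ N s U v) (ht : t ∈ U)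
    (hs : v t ∈ K.chart.source) (l k : Fin n) {i j : Fin n} (hij : i ≠ j) :
    corrForm₄ (Θ.freeEnergy N s v) t (K.frame l (K.chart (v t))) (K.frame k (K.chart (v t)))
        (K.frame i (K.chart (v t))) (K.frame j (K.chart (v t))) +
      K.velocityPair v t l / K.metricCoeff l (K.chart (v t)) *
        (corrForm₃ (Θ.freeEnergy N s v) t (K.frame k (K.chart (v t)))
            (K.frameDeriv l i (K.chart (v t))) (K.frame j (K.chart (v t))) +
          corrForm₃ (Θ.freeEnergy N s v) t (K.frame k (K.chart (v t)))
            (K.frame i (K.chart (v t))) (K.frameDeriv l j (K.chart (v t)))) = 0 := by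
  have hf := fun i α => hv.analyticAt_frame_comp ht hs i α
  have hC := fun δ γ α : Fin n => analyticOnNhd_corr hv.analyticOnNhd_freeEnergy [δ, γ, α] t ht
  -- For `i ≠ j` the three-point tensor vanishes on `(·, f_i, f_j)` wherever `v` stays in the chart,
  -- hence so do its derivatives. The frame moves with `t`, so the product rule also differentiates
  -- `f_i` and `f_j`.
  have h0 : ∀ δ β : Fin n, pd β (fun t => ∑ γ, ∑ α, corr (Θ.freeEnergy N s v) [δ, γ, α] t *
      (K.frame i (K.chart (v t)) γ * K.frame j (K.chart (v t)) α)) t = 0 := fun δ β => by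
    rw [pd_congr_of_eqOn (g := fun _ => 0) (U := U ∩ v ⁻¹' K.chart.source)
      (hv.analytic.continuousOn.isOpen_inter_preimage hv.isOpen K.chart.open_source)
      (fun τ hτ => ?_) ⟨ht, hs⟩, pd_const]
    have h1 := hv.corrForm₃_eq hτ.1 (Pi.single δ 1) (K.frame i (K.chart (v τ)))
      (K.frame j (K.chart (v τ)))
    have h2 := K.trilinear_frame (K.chart.map_source hτ.2) i j (Pi.single δ 1 ᵥ* jacobian v τ)
    rw [K.chart.left_inv hτ.2, if_neg hij] at h2
    rw [X.trilinear_swap_left (hv.mapsTo hτ.1), X.trilinear_swap_right (hv.mapsTo hτ.1), h2,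
      corrForm₃, Finset.sum_eq_single δ (fun a _ ha => by simp [ha]) (by simp)] at h1
    simpa using h1
  have h1 : ∀ δ β : Fin n, ∑ γ, ∑ α, (corr (Θ.freeEnergy N s v) [β, δ, γ, α] t *
        (K.frame i (K.chart (v t)) γ * K.frame j (K.chart (v t)) α) +
      corr (Θ.freeEnergy N s v) [δ, γ, α] t *
        (pd β (fun t => K.frame i (K.chart (v t)) γ) t * K.frame j (K.chart (v t)) α +
          K.frame i (K.chart (v t)) γ * pd β (fun t => K.frame j (K.chart (v t)) α) t)) = 0 :=
      fun δ β => by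
    rw [← h0 δ β, pd_sum _ fun γ _ => Finset.analyticAt_fun_sum _ fun α _ =>
      (hC δ γ α).fun_mul ((hf i γ).fun_mul (hf j α))]
    refine Finset.sum_congr rfl fun γ _ => ?_
    rw [pd_sum _ fun α _ => (hC δ γ α).fun_mul ((hf i γ).fun_mul (hf j α))]
    refine Finset.sum_congr rfl fun α _ => ?_
    rw [pd_mul (hC δ γ α) ((hf i γ).fun_mul (hf j α)), pd_mul (hf i γ) (hf j α)]
    rfl
  have e1 : K.velocityPair v t l / K.metricCoeff l (K.chart (v t)) *
      corrForm₃ (Θ.freeEnergy N s v) t (K.frame k (K.chart (v t)))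
        (K.frameDeriv l i (K.chart (v t))) (K.frame j (K.chart (v t))) =
      ∑ β, ∑ δ, ∑ γ, ∑ α, K.frame l (K.chart (v t)) β * K.frame k (K.chart (v t)) δ *
        (corr (Θ.freeEnergy N s v) [δ, γ, α] t *
          (pd β (fun t => K.frame i (K.chart (v t)) γ) t * K.frame j (K.chart (v t)) α)) := by
    rw [corrForm₃, Finset.mul_sum, Finset.sum_comm]
    refine Finset.sum_congr rfl fun δ _ => ?_
    rw [Finset.mul_sum, Finset.sum_comm]
    refine Finset.sum_congr rfl fun γ _ => ?_
    rw [Finset.mul_sum, Finset.sum_comm]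
    refine Finset.sum_congr rfl fun α _ => ?_
    calc _ = (K.velocityPair v t l / K.metricCoeff l (K.chart (v t)) *
          K.frameDeriv l i (K.chart (v t)) γ) * (K.frame k (K.chart (v t)) δ *
            corr (Θ.freeEnergy N s v) [δ, γ, α] t * K.frame j (K.chart (v t)) α) := by ring
      _ = _ := by
        rw [← hv.sum_frame_mul_pd_frame ht hs, Finset.sum_mul]
        exact Finset.sum_congr rfl fun _ _ => by ring
  have e2 : K.velocityPair v t l / K.metricCoeff l (K.chart (v t)) *
      corrForm₃ (Θ.freeEnergy N s v) t (K.frame k (K.chart (v t)))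
        (K.frame i (K.chart (v t))) (K.frameDeriv l j (K.chart (v t))) =
      ∑ β, ∑ δ, ∑ γ, ∑ α, K.frame l (K.chart (v t)) β * K.frame k (K.chart (v t)) δ *
        (corr (Θ.freeEnergy N s v) [δ, γ, α] t *
          (K.frame i (K.chart (v t)) γ * pd β (fun t => K.frame j (K.chart (v t)) α) t)) := by
    rw [corrForm₃, Finset.mul_sum, Finset.sum_comm]
    refine Finset.sum_congr rfl fun δ _ => ?_
    rw [Finset.mul_sum, Finset.sum_comm]
    refine Finset.sum_congr rfl fun γ _ => ?_
    rw [Finset.mul_sum, Finset.sum_comm]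
    refine Finset.sum_congr rfl fun α _ => ?_
    calc _ = (K.velocityPair v t l / K.metricCoeff l (K.chart (v t)) *
          K.frameDeriv l j (K.chart (v t)) α) * (K.frame k (K.chart (v t)) δ *
            corr (Θ.freeEnergy N s v) [δ, γ, α] t * K.frame i (K.chart (v t)) γ) := by ring
      _ = _ := by
        rw [← hv.sum_frame_mul_pd_frame ht hs, Finset.sum_mul]
        exact Finset.sum_congr rfl fun _ _ => by ring
  rw [mul_add, e1, e2, corrForm₄]
  simp only [← Finset.sum_add_distrib]
  refine Finset.sum_eq_zero fun β _ => Finset.sum_eq_zero fun δ _ => ?_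
  rw [← mul_zero (K.frame l (K.chart (v t)) β * K.frame k (K.chart (v t)) δ), ← h1 δ β]
  simp only [Finset.mul_sum]
  exact Finset.sum_congr rfl fun γ _ => Finset.sum_congr rfl fun α _ => by ring

end IsTopologicalSolution

end FrobeniusManifold

/-! ### Expansion of `O₁` and `O₂` in a frame diagonalising `M⁻¹`. -/

theorem Fintype.sum_fin_two_arrow {α M : Type*} [Fintype α] [AddCommMonoid M]
    (f : (Fin 2 → α) → M) : ∑ a, f a = ∑ x, ∑ y, f ![x, y] := by
  rw [← (finTwoArrowEquiv α).symm.sum_comp, Fintype.sum_prod_type]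
  rfl

theorem Fintype.sum_fin_three_arrow {α M : Type*} [Fintype α] [AddCommMonoid M]
    (f : (Fin 3 → α) → M) : ∑ a, f a = ∑ x, ∑ y, ∑ z, f ![x, y, z] := by
  rw [← (Fin.consEquiv fun _ : Fin 3 => α).sum_comp, Fintype.sum_prod_type]
  exact Finset.sum_congr rfl fun x _ => Fintype.sum_fin_two_arrow _

namespace DualGraph

variable {n : ℕ} [NeZero n] {F₀ : (Fin n → ℂ) → ℂ} {t : Fin n → ℂ}
  {f : Fin n → Fin n → ℂ} {m : Fin n → ℂ}

/-- The function of a graph in a frame `f_i` with `M⁻¹ = ∑ m_i⁻¹ f_i ⊗ f_i`. -/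
theorem value_eq_sum_frame (hM : ∀ a b, (corrMatrix F₀ t)⁻¹ a b = ∑ i, f i a * f i b / m i)
    (Γ : DualGraph) :
    Γ.value F₀ t = ∑ κ : Fin Γ.numEdges → Fin n, (∏ e, (m (κ e))⁻¹) *
      ∑ a : Fin Γ.numEdges → Fin n, ∑ b : Fin Γ.numEdges → Fin n,
        (∏ e, f (κ e) (a e) * f (κ e) (b e)) *
        ∏ w, corr F₀ (List.replicate (Γ.legs w) 0 ++
          (List.finRange Γ.numEdges).flatMap fun e =>
            (if (Γ.ends e).1 = w then [a e] else []) ++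
            (if (Γ.ends e).2 = w then [b e] else [])) t := by
  simp only [value, hM, Finset.prod_univ_sum, Fintype.piFinset_univ, Finset.sum_mul,
    Finset.mul_sum]
  refine Eq.trans ?_ Finset.sum_comm
  refine Finset.sum_congr rfl fun a _ => Eq.trans ?_ Finset.sum_comm
  refine Finset.sum_congr rfl fun b _ => Finset.sum_congr rfl fun κ _ => ?_
  simp only [div_eq_inv_mul, Finset.prod_mul_distrib]
  ring

theorem value_graphO1 (hM : ∀ a b, (corrMatrix F₀ t)⁻¹ a b = ∑ i, f i a * f i b / m i) :
    graphO1.value F₀ t =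
      ∑ i, ∑ j, (m i)⁻¹ * (m j)⁻¹ * corrForm₄ F₀ t (f i) (f i) (f j) (f j) := by
  refine (value_eq_sum_frame hM graphO1).trans ((Fintype.sum_fin_two_arrow _).trans ?_)
  refine Finset.sum_congr rfl fun i _ => Finset.sum_congr rfl fun j _ => ?_
  refine congrArg₂ _ (Fin.prod_univ_two _) ((Fintype.sum_fin_two_arrow _).trans ?_)
  -- The vertex lists its half-edges edge by edge, so the sums are reordered to `a 0, b 0, a 1, b
  -- 1`.
  refine Finset.sum_congr rfl fun a _ => Eq.trans ?_ Finset.sum_comm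
  refine Finset.sum_congr rfl fun c _ => (Fintype.sum_fin_two_arrow _).trans ?_
  refine Finset.sum_congr rfl fun b _ => Finset.sum_congr rfl fun d _ => ?_
  refine (congrArg₂ _ (Fin.prod_univ_two _) (Fin.prod_univ_one _)).trans ?_
  change f i a * f i b * (f j c * f j d) * corr F₀ [a, b, c, d] t = _
  ring

theorem value_graphO2 (hM : ∀ a b, (corrMatrix F₀ t)⁻¹ a b = ∑ i, f i a * f i b / m i) :
    graphO2.value F₀ t =
      ∑ i, ∑ j, ∑ k, (m i)⁻¹ * (m j)⁻¹ * (m k)⁻¹ *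
        (corrForm₄ F₀ t (Pi.single 0 1) (f i) (f j) (f k) *
          corrForm₃ F₀ t (f i) (f j) (f k)) := by
  refine (value_eq_sum_frame hM graphO2).trans ((Fintype.sum_fin_three_arrow _).trans ?_)
  refine Finset.sum_congr rfl fun i _ => Finset.sum_congr rfl fun j _ =>
    Finset.sum_congr rfl fun k _ => ?_
  refine congrArg₂ _ (Fin.prod_univ_three _) ((Fintype.sum_fin_three_arrow _).trans ?_)
  rw [corrForm₄_single_left]
  simp only [Finset.sum_mul]
  refine Finset.sum_congr rfl fun x _ => Finset.sum_congr rfl fun y _ =>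
    Finset.sum_congr rfl fun z _ => (Fintype.sum_fin_three_arrow _).trans ?_
  simp only [corrForm₃, Finset.mul_sum]
  refine Finset.sum_congr rfl fun a _ => Finset.sum_congr rfl fun b _ =>
    Finset.sum_congr rfl fun c _ => ?_
  refine (congrArg₂ _ (Fin.prod_univ_three _) (Fin.prod_univ_two _)).trans ?_
  change f i x * f i a * (f j y * f j b) * (f k z * f k c) *
    (corr F₀ [0, x, y, z] t * corr F₀ [a, b, c] t) = _
  ring

end DualGraph

/-! ### Evaluation of `O₁ - O₂`. -/

namespace FrobeniusManifold

open Matrix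

variable {n : ℕ} [NeZero n] {X : FrobeniusManifold n} {Θ : X.Calibration} {N : ℕ}
  {s : ℕ → Fin n → ℂ} {U : Set (Fin n → ℂ)} {v : (Fin n → ℂ) → (Fin n → ℂ)} {t : Fin n → ℂ}
  {K : X.CanonicalCoordinates}

namespace CanonicalCoordinates.IsLame

variable {h : Fin n → (Fin n → ℂ) → ℂ} {u : Fin n → ℂ}

theorem ne_zero (hh : K.IsLame h) (hu : u ∈ K.chart.target) (i : Fin n) : h i u ≠ 0 := fun h0 =>
  K.metricCoeff_ne_zero hu i (by rw [← hh.sq_eq i u hu, h0]; ring)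

theorem pd_metricCoeff_eq (hh : K.IsLame h) (hu : u ∈ K.chart.target) {i j : Fin n}
    (hij : i ≠ j) : pd i (K.metricCoeff j) u = 2 * (h i u * h j u * rotationCoeff h i j u) := by
  have h1 : pd i (K.metricCoeff j) u = pd i (fun u => h j u * h j u) u :=
    pd_congr_of_eqOn K.chart.open_target
      (fun u hu => by simp only [← hh.sq_eq j u hu, sq]) hu
  have hi := hh.ne_zero hu i
  rw [h1, pd_mul (hh.analytic j u hu) (hh.analytic j u hu), rotationCoeff, if_neg hij]
  field_simp
  ring

end CanonicalCoordinates.IsLame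

namespace IsTopologicalSolution

/-- The case `l = j`, `k = i` of `corrForm₄_frame`: the term with `∂_j f_i` vanishes, and `⟨f_i, ∂_j
f_j⟩ = -∂_i η_jj / 2` remains. -/
theorem corrForm₄_frame_jiij (hv : X.IsTopologicalSolution Θ N s U v) (ht : t ∈ U)
    (hs : v t ∈ K.chart.source) {i j : Fin n} (hij : i ≠ j) :
    corrForm₄ (Θ.freeEnergy N s v) t (K.frame j (K.chart (v t))) (K.frame i (K.chart (v t)))
        (K.frame i (K.chart (v t))) (K.frame j (K.chart (v t))) =
      K.velocityPair v t i / K.metricCoeff i (K.chart (v t)) *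
        (K.velocityPair v t j / K.metricCoeff j (K.chart (v t))) *
          (pd i (K.metricCoeff j) (K.chart (v t)) / 2) := by
  have h := hv.corrForm₄_frame ht hs j i hij
  rw [hv.corrForm₃_swap ht _ _ (K.frame j _), hv.corrForm₃_frame ht hs, if_neg hij,
    hv.corrForm₃_frame ht hs, if_pos rfl,
    K.frame_pair_frameDeriv_right (K.chart.map_source hs) hij] at h
  rw [eq_neg_of_add_eq_zero_left h]
  ring

/-- The case `l = k = i`: here `⟨f_i, ∂_i f_j⟩ = ∂_j η_ii / 2` remains, rewritten by the Egorov
property. -/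
theorem corrForm₄_frame_iiij (hv : X.IsTopologicalSolution Θ N s U v) (ht : t ∈ U)
    (hs : v t ∈ K.chart.source) {i j : Fin n} (hij : i ≠ j) :
    corrForm₄ (Θ.freeEnergy N s v) t (K.frame i (K.chart (v t))) (K.frame i (K.chart (v t)))
        (K.frame i (K.chart (v t))) (K.frame j (K.chart (v t))) =
      -((K.velocityPair v t i / K.metricCoeff i (K.chart (v t))) ^ 2 *
          (pd i (K.metricCoeff j) (K.chart (v t)) / 2)) := by
  have h := hv.corrForm₄_frame ht hs i i hij
  rw [hv.corrForm₃_swap ht _ _ (K.frame j _), hv.corrForm₃_frame ht hs, if_neg hij,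
    hv.corrForm₃_frame ht hs, if_pos rfl,
    K.frame_pair_frameDeriv_left (K.chart.map_source hs),
    K.pd_metricCoeff_comm (K.chart.map_source hs)] at h
  rw [eq_neg_of_add_eq_zero_left h]
  ring

/-- The three-point vertex forces the three edge indices to agree and then equals `m_i`, cancelling
one propagator; the leg of the other vertex is `e = ∑ f_j`. -/
theorem value_graphO2_eq (hv : X.IsTopologicalSolution Θ N s U v) (ht : t ∈ U)
    (hs : v t ∈ K.chart.source) :
    graphO2.value (Θ.freeEnergy N s v) t = ∑ i, ∑ j, ((K.velocityPair v t i) ^ 2)⁻¹ *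
      corrForm₄ (Θ.freeEnergy N s v) t (K.frame i (K.chart (v t))) (K.frame i (K.chart (v t)))
        (K.frame i (K.chart (v t))) (K.frame j (K.chart (v t))) := by
  have hu := K.chart.map_source hs
  have hF := hv.analyticOnNhd_freeEnergy
  rw [DualGraph.value_graphO2 (hv.inv_corrMatrix_apply ht hs)]
  refine Finset.sum_congr rfl fun i _ => ?_
  rw [Finset.sum_eq_single i _ (by simp), Finset.sum_eq_single i _ (by simp)]
  · rw [K.unit_eq_sum_frame hu, corrForm₄_sum_left, hv.corrForm₃_frame ht hs, if_pos rfl,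
      K.frame_pair_eq hu, if_pos rfl, div_mul_cancel₀ _ (K.metricCoeff_ne_zero hu i),
      Finset.sum_mul, Finset.mul_sum]
    refine Finset.sum_congr rfl fun j _ => ?_
    rw [corrForm₄_swap₁₂ hv.isOpen hF ht, corrForm₄_swap₂₃ hv.isOpen hF ht,
      corrForm₄_swap₃₄ hv.isOpen hF ht]
    have hm := hv.velocityPair_ne_zero ht hs i
    field_simp
  · intro k _ hk
    rw [hv.corrForm₃_frame ht hs, if_pos rfl, K.frame_pair_of_ne hu hk.symm]
    ring
  · intro j _ hj
    refine Finset.sum_eq_zero fun k _ => ?_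
    rw [hv.corrForm₃_frame ht hs, if_neg hj.symm]
    ring

theorem value_graphO1_sub_value_graphO2 (hv : X.IsTopologicalSolution Θ N s U v) (ht : t ∈ U)
    (hs : v t ∈ K.chart.source) {h : Fin n → (Fin n → ℂ) → ℂ} (hh : K.IsLame h) :
    graphO1.value (Θ.freeEnergy N s v) t - graphO2.value (Θ.freeEnergy N s v) t =
      ∑ i, ∑ j ∈ Finset.Ioi i, rotationCoeff h i j (K.chart (v t)) *
        (((h i (K.chart (v t))) ^ 2 + (h j (K.chart (v t))) ^ 2) ^ 2 /
          ((h i (K.chart (v t))) ^ 3 * (h j (K.chart (v t))) ^ 3)) := by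
  have hu := K.chart.map_source hs
  have hF := hv.analyticOnNhd_freeEnergy
  have hterm : ∀ i j, (K.velocityPair v t i)⁻¹ * (K.velocityPair v t j)⁻¹ *
        corrForm₄ (Θ.freeEnergy N s v) t (K.frame i (K.chart (v t))) (K.frame i (K.chart (v t)))
          (K.frame j (K.chart (v t))) (K.frame j (K.chart (v t))) -
      ((K.velocityPair v t i) ^ 2)⁻¹ *
        corrForm₄ (Θ.freeEnergy N s v) t (K.frame i (K.chart (v t))) (K.frame i (K.chart (v t)))
          (K.frame i (K.chart (v t))) (K.frame j (K.chart (v t))) =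
      if i = j then 0 else pd i (K.metricCoeff j) (K.chart (v t)) / 2 *
        (1 / (K.metricCoeff i (K.chart (v t)) * K.metricCoeff j (K.chart (v t))) +
          1 / (K.metricCoeff i (K.chart (v t))) ^ 2) := fun i j => by
    -- For `i = j` both terms are the same multiple of the four-point value on `(f_i, f_i, f_i,
    -- f_i)`, which need not be known.
    by_cases hij : i = j
    · subst hij
      rw [if_pos rfl]
      ring
    · rw [if_neg hij, corrForm₄_swap₂₃ hv.isOpen hF ht, corrForm₄_swap₁₂ hv.isOpen hF ht,
        hv.corrForm₄_frame_jiij ht hs hij, hv.corrForm₄_frame_iiij ht hs hij]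
      have h1 := hv.velocityPair_ne_zero ht hs i
      have h2 := hv.velocityPair_ne_zero ht hs j
      have h3 := K.metricCoeff_ne_zero hu i
      have h4 := K.metricCoeff_ne_zero hu j
      field_simp
      ring
  rw [DualGraph.value_graphO1 (hv.inv_corrMatrix_apply ht hs), hv.value_graphO2_eq ht hs,
    ← Finset.sum_sub_distrib]
  simp_rw [← Finset.sum_sub_distrib, hterm]
  have hoff : ∀ i : Fin n, ∀ G : Fin n → ℂ, (∑ j, if i = j then 0 else G j) =
      ∑ j ∈ {i}ᶜ, if i = j then 0 else G j := fun i G =>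
    (Finset.sum_subset (Finset.subset_univ _) fun j _ hj => by
      rw [Finset.mem_compl, Finset.mem_singleton, not_not] at hj
      rw [if_pos hj.symm]).symm
  simp_rw [hoff]
  -- The off-diagonal sum is folded onto `i < j`; the Egorov property gives both terms the common
  -- factor `∂_i η_jj`.
  rw [← Finset.sum_sum_Ioi_add_eq_sum_sum_off_diag fun j i => if i = j then 0 else _]
  refine Finset.sum_congr rfl fun i _ => Finset.sum_congr rfl fun j hj => ?_
  have hij : i ≠ j := (Finset.mem_Ioi.1 hj).ne
  rw [if_neg hij, if_neg hij.symm, K.pd_metricCoeff_comm hu j i, hh.pd_metricCoeff_eq hu hij,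
    ← hh.sq_eq i _ hu, ← hh.sq_eq j _ hu]
  have hi := hh.ne_zero hu i
  have hj := hh.ne_zero hu j
  field_simp
  ring

end IsTopologicalSolution

end FrobeniusManifold

theorem mainTheorem4 {n : ℕ} [NeZero n] (X : FrobeniusManifold n) (Θ : X.Calibration)
    (N : ℕ) (hN : 1 ≤ N) (s : ℕ → Fin n → ℂ) (U : Set (Fin n → ℂ))
    (v : (Fin n → ℂ) → (Fin n → ℂ)) (hv : X.IsTopologicalSolution Θ N s U v)
    (F₀ : (Fin n → ℂ) → ℂ) (hF₀ : F₀ = Θ.freeEnergy N s v) :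
    (∀ t ∈ U, IsUnit (corrMatrix F₀ t).det) ∧
    (∀ (K : X.CanonicalCoordinates) (h : Fin n → (Fin n → ℂ) → ℂ), K.IsLame h →
      ∀ t ∈ U, v t ∈ K.chart.source →
        (∀ i, h i (K.chart (v t)) ≠ 0) ∧
        graphO1.value F₀ t - graphO2.value F₀ t =
          ∑ i, ∑ j ∈ Finset.Ioi i, rotationCoeff h i j (K.chart (v t)) *
            (((h i (K.chart (v t))) ^ 2 + (h j (K.chart (v t))) ^ 2) ^ 2 /
              ((h i (K.chart (v t))) ^ 3 * (h j (K.chart (v t))) ^ 3))) ∧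
    (∀ t ∈ U,
      pd 0 (graphP1.value F₀) t = graphQ1.value F₀ t - 2 * graphQ3.value F₀ t ∧
      pd 0 (graphP2.value F₀) t =
        graphQ3.value F₀ t + graphQ5.value F₀ t - graphQ7.value F₀ t - 2 * graphQ9.value F₀ t ∧
      pd 0 (graphP3.value F₀) t =
        graphQ4.value F₀ t + graphQ8.value F₀ t + graphQ10.value F₀ t
          - 2 * graphQ11.value F₀ t - 2 * graphQ12.value F₀ t ∧
      pd 0 (graphP4.value F₀) t =
        graphQ6.value F₀ t + graphQ2.value F₀ t - 3 * graphQ10.value F₀ t ∧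
      pd 0 (graphP5.value F₀) t = 2 * graphQ2.value F₀ t - 3 * graphQ4.value F₀ t ∧
      pd 0 (graphO1.value F₀) t = graphP1.value F₀ t - 2 * graphP2.value F₀ t ∧
      pd 0 (graphO2.value F₀) t =
        graphP4.value F₀ t + graphP5.value F₀ t - 3 * graphP3.value F₀ t) ∧
    (∀ t ∈ U, graphRelation F₀ t =
      pd 0 (pd 0 fun τ => graphO1.value F₀ τ - graphO2.value F₀ τ) t) := by
  subst hF₀
  have hF := hv.analyticOnNhd_freeEnergy
  have hM := fun t (ht : t ∈ U) => hv.isUnit_det_corrMatrix ht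
  refine ⟨hM, fun K h hh t ht hs => ⟨hh.ne_zero (K.chart.map_source hs),
    hv.value_graphO1_sub_value_graphO2 ht hs hh⟩, fun t ht => ?_,
    fun t ht => DualGraph.graphRelation_eq hv.isOpen hF hM ht⟩
  exact ⟨DualGraph.pd_value_graphP1 hv.isOpen hF ht (hM t ht),
    DualGraph.pd_value_graphP2 hv.isOpen hF ht (hM t ht),
    DualGraph.pd_value_graphP3 hv.isOpen hF ht (hM t ht),
    DualGraph.pd_value_graphP4 hv.isOpen hF ht (hM t ht),
    DualGraph.pd_value_graphP5 hv.isOpen hF ht (hM t ht),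
    DualGraph.pd_value_graphO1 hv.isOpen hF ht (hM t ht),
    DualGraph.pd_value_graphO2 hv.isOpen hF ht (hM t ht)⟩
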